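/- Let $N\ge 1$, $a\in\mathbb C$, and let $\mathbf r,\mathbf l\in\mathbb C^N$ satisfy $\mathbf l^*\mathbf r=1$. Put $A=a\,\mathbf r\,\mathbf l^*$ and $X=G+A$, where $G$ is an $N\times N$ complex Ginibre matrix (independent entries $(x+iy)/\sqrt2$ with $x,y$ independent real standard normal). Almost surely $X$ has $N$ distinct eigenvalues $z_1,\dots,z_N$; for $\theta\in[0,2\pi)$ let $\mathbf v_k(\theta)$ be the eigenvector $X\mathbf v_k=z_k\mathbf v_k$ with $\mathbf v_k^*\mathbf v_k=1$ whose first entry has phase $\theta$. Let $$\Pi_N=\sum_{k=1}^N\int_0^{2\pi}\delta_{(z_k,\mathbf v_k(\theta))}\,\frac{d\theta}{2\pi}$$ be the phase-averaged joint empirical measure on $\mathbb C\times\{\mathbf v\in\mathbb C^N:\mathbf v^*\mathbf v=1\}$, let $\langle\Pi_N\rangle$ be its expectation, and let $\mu_H$ be the uniform probability measure on the complex unit sphere. With $\Gamma(s,x)=\int_x^\infty t^{s-1}e^{-t}\,dt$, define $$F(z,\mathbf v)=\frac{1}{\pi\Gamma(N)}\,e^{-|a|^2\,\mathbf r^*\mathbf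 r\,|\mathbf v^*\mathbf l|^2+a\bar z(\mathbf l^*\mathbf v)(\mathbf v^*\mathbf r)+\bar a z(\mathbf r^*\mathbf v)(\mathbf v^*\mathbf l)}\Big\{\Gamma(N,|z|^2)$$ $$+\,\Gamma(N-1,|z|^2)\Big[|a|^2(\mathbf r^*\mathbf r-|\mathbf r^*\mathbf v|^2)(\mathbf l^*\mathbf l-|\mathbf l^*\mathbf v|^2)-a\bar z\big(1-(\mathbf l^*\mathbf v)(\mathbf v^*\mathbf r)\big)-\bar a z\big(1-(\mathbf r^*\mathbf v)(\mathbf v^*\mathbf l)\big)\Big]$$ $$-\,|a|^2|z|^2\,\Gamma(N-2,|z|^2)\Big[(\mathbf r^*\mathbf r-|\mathbf r^*\mathbf v|^2)(\mathbf l^*\mathbf l-|\mathbf l^*\mathbf v|^2)-\big|1-(\mathbf r^*\mathbf v)(\mathbf v^*\mathbf l)\big|^2\Big]\Big\},$$ where, if $N\le 2$, a term with vanishing coefficient is read as $0$. Then $F\ge 0$, the measure $\langle\Pi_N\rangle$ has density $F(z,\mathbf v)$ with respect to $d^2z\,d\mu_H(\mathbf v)$, and consequently the joint probability law $\frac1N\langle\Pi_N\rangle$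 of an eigenvalue and its normalized right eigenvector has density $\mathcal P^{(A)}_N(z,\mathbf v)=\frac1N F(z,\mathbf v)$. -/

import Mathlib

open MeasureTheory ProbabilityTheory
open scoped ComplexConjugate

noncomputable section

namespace DeformedGinibre

/-- Column vectors of length `N` with the Hermitian inner product;
`inner ℂ x y` is `x* y = ∑ i, conj (x i) * y i`. -/
abbrev CVec (N : ℕ) : Type := EuclideanSpace ℂ (Fin N)

/-- The complex unit sphere `v* v = 1` in `ℂ^N`. -/
abbrev CSphere (N : ℕ) : Type := Metric.sphere (0 : CVec N) 1

/-- The uniform (unitarily invariant) measure on the complex unit sphere: the surface measure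
induced by Lebesgue measure on `ℂ^N`, normalised to total mass one. -/
def haarSphere (N : ℕ) : Measure (CSphere N) :=
  ((volume : Measure (CVec N)).toSphere Set.univ)⁻¹ • (volume : Measure (CVec N)).toSphere

/-- The standard complex normal law: the law of `(x + i y) / √2`
for independent real standard normal `x`, `y`. -/
def complexNormal : Measure ℂ :=
  ((gaussianReal 0 1).prod (gaussianReal 0 1)).map
    (fun p : ℝ × ℝ => ((p.1 : ℂ) + Complex.I * (p.2 : ℂ)) / ((Real.sqrt 2 : ℝ) : ℂ))

/-- The complex Ginibre ensemble: the law of an `N × N` array of independent standard complex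
normal entries. -/
def ginibre (N : ℕ) : Measure (Fin N → Fin N → ℂ) :=
  Measure.pi fun _ => Measure.pi fun _ => complexNormal

/-- `v` is a normalised right eigenvector of `X` for the eigenvalue `z`. -/
def IsUnitEigenvector {N : ℕ} (X : Matrix (Fin N) (Fin N) ℂ) (z : ℂ) (v : CSphere N) : Prop :=
  X.mulVec (v : CVec N).ofLp = z • (v : CVec N).ofLp

/-- The multiple of the unit vector `v` by a phase factor whose first entry has phase `θ`,
that is, whose first entry is `|v₁| * exp (i θ)`. -/
def withPhase {N : ℕ} [NeZero N] (v : CSphere N) (θ : ℝ) : CSphere N :=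
  ⟨Complex.exp (((θ - Complex.arg ((v : CVec N) 0) : ℝ) : ℂ) * Complex.I) • (v : CVec N), by
    have hv : ‖(v : CVec N)‖ = 1 := by simp
    rw [mem_sphere_zero_iff_norm, norm_smul, Complex.norm_exp_ofReal_mul_I, hv, one_mul]⟩

/-- The average over `θ`, uniform in `[0, 2π)`, of the unit point mass at
`(z, withPhase v θ)`. -/
def phaseAverage {N : ℕ} [NeZero N] (z : ℂ) (v : CSphere N) : Measure (ℂ × CSphere N) :=
  (ENNReal.ofReal (2 * Real.pi))⁻¹ •
    ((volume : Measure ℝ).restrict (Set.Ico 0 (2 * Real.pi))).map (fun θ => (z, withPhase v θ))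

open Classical in
/-- The contribution of an eigenvalue `z` of `X` to the joint empirical measure: the phase average
at `(z, v)`, where `v` is a unit eigenvector. If `z` is a simple eigenvalue, the result
does not depend on which unit eigenvector is chosen. -/
def eigenpairMeasure {N : ℕ} [NeZero N] (X : Matrix (Fin N) (Fin N) ℂ) (z : ℂ) :
    Measure (ℂ × CSphere N) :=
  if h : ∃ v : CSphere N, IsUnitEigenvector X z v then phaseAverage z h.choose else 0

/-- The joint empirical measure of the `N` eigenvalues of `X` and the corresponding normalised
right eigenvectors, averaged over the common phase of the first entries of the eigenvectors. -/
def empiricalMeasure {N : ℕ} [NeZero N] (X : Matrix (Fin N) (Fin N) ℂ) :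
    Measure (ℂ × CSphere N) :=
  (X.charpoly.roots.map (eigenpairMeasure X)).sum

/-- The expectation of the joint empirical measure of `G + A`, with `G` complex Ginibre. -/
def meanEmpiricalMeasure {N : ℕ} [NeZero N] (A : Matrix (Fin N) (Fin N) ℂ) :
    Measure (ℂ × CSphere N) :=
  (ginibre N).bind (fun G => empiricalMeasure (Matrix.of G + A))

/-- The joint law of an eigenvalue and its normalised right eigenvector for `G + A`, with `G`
complex Ginibre: the expected joint empirical measure divided by `N`. -/
def jointLaw {N : ℕ} [NeZero N] (A : Matrix (Fin N) (Fin N) ℂ) : Measure (ℂ × CSphere N) :=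
  (N : ENNReal)⁻¹ • meanEmpiricalMeasure A

/-- The matrix `a r l*`. -/
def rankOne {N : ℕ} (a : ℂ) (r l : CVec N) : Matrix (Fin N) (Fin N) ℂ :=
  a • Matrix.vecMulVec r.ofLp (star l.ofLp)

/-- The upper incomplete Gamma function `Γ(s, x) = ∫_x^∞ t^(s-1) e^(-t) dt`. -/
def upperGamma (s x : ℝ) : ℝ :=
  ∫ t in Set.Ioi x, t ^ (s - 1) * Real.exp (-t)

/-- The function
`e^{-|a|² r*r |v*l|² + a z̄ (l*v)(v*r) + ā z (r*v)(v*l)} / (π Γ(N)) * { Γ(N,|z|²)`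
`  + Γ(N-1,|z|²) [|a|² (r*r - |r*v|²)(l*l - |l*v|²) - a z̄ (1 - (l*v)(v*r)) - ā z (1 - (r*v)(v*l))]`
`  - |a|²|z|² Γ(N-2,|z|²) [(r*r - |r*v|²)(l*l - |l*v|²) - |1 - (r*v)(v*l)|²] }`.
Real parts are taken only of sums of two complex conjugate terms. -/
def rankOneDensity {N : ℕ} (a : ℂ) (r l : CVec N) (z : ℂ) (v : CVec N) : ℝ :=
  1 / (Real.pi * Real.Gamma N) *
    Real.exp (-(‖a‖ ^ 2 * ‖r‖ ^ 2 * ‖inner ℂ v l‖ ^ 2)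
      + (a * conj z * (inner ℂ l v * inner ℂ v r)
        + conj a * z * (inner ℂ r v * inner ℂ v l)).re) *
    (upperGamma N (‖z‖ ^ 2)
      + upperGamma ((N : ℝ) - 1) (‖z‖ ^ 2) *
        (‖a‖ ^ 2 * ((‖r‖ ^ 2 - ‖inner ℂ r v‖ ^ 2) * (‖l‖ ^ 2 - ‖inner ℂ l v‖ ^ 2))
          - (a * conj z * (1 - inner ℂ l v * inner ℂ v r)
            + conj a * z * (1 - inner ℂ r v * inner ℂ v l)).re)
      - ‖a‖ ^ 2 * ‖z‖ ^ 2 * upperGamma ((N : ℝ) - 2) (‖z‖ ^ 2) *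
        ((‖r‖ ^ 2 - ‖inner ℂ r v‖ ^ 2) * (‖l‖ ^ 2 - ‖inner ℂ l v‖ ^ 2)
          - ‖1 - inner ℂ r v * inner ℂ v l‖ ^ 2))

end DeformedGinibre

end

/-! With `N = n + 1`, describe a matrix having eigenvalue `z` and eigenvector proportional to `(1,
u)` by `z`, `u` and its last `n` columns `R`; the first column is then determined. This is the map
`chart`. Its fibre over `X` is the set of eigenpairs of `X`, and its real Jacobian is `|χ'(z)|²`,
where `χ` is the characteristic polynomial (`abs_det_fderiv_chart`). Almost every matrix has simple
spectrum and no eigenvector with vanishing first entry, so the empirical measure is a sum over a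
regular fibre (`empiricalMeasure_toMat`). The area formula then turns its expectation into an
integral over `(z, u, R)` of the Gaussian density times the Jacobian (`meanEmpiricalMeasure_apply`).

For fixed `(z, u)` the integral over `R` is computed in a unitary frame `Q` whose first vector is
the unit eigenvector `v` (`lintegral_chart_fiber`). There `X = Q B Q*` with `B` block triangular,
`χ'(z)` is the determinant of `z` minus the lower right block, and the Gaussian density factors. The
first column gives the exponential in `F` up to a factor `e^{-|z|²}`, the top row integrates to one,
and the rest is the second moment of the determinant of a Gaussian matrix with mean `C`.

The second frame vector is taken in the span of `v` and `r`. All rows of `C` but one are then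
diagonal, and the moment collapses to the permanent of the matrix `|C i j|² + 1`
(`integral_norm_sq_det`). Expanding along the exceptional row leaves permanents of matrices with
diagonal `1 + |z|²` and ones elsewhere, which equal `e^{|z|²} Γ(k+1, |z|²)`
(`permSum_eq_upperGamma`). Parseval's identity and `l* r = 1` turn the frame coefficients into the
brackets of `F` (`rankOneDensity_eq`).

With `ν` the norm of `(1, u)`, the change of variables in `R` contributes `ν^(-2(n+1))`. Up to the
constant `n!/π^n` this is the density of the uniform sphere measure in the coordinate `u` with the
phase averaged (`lintegral_haarSphere_chart`), so `F` is exactly what remains. -/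

noncomputable section

namespace DeformedGinibre

/-! ### The area formula as an identity of measures -/

section AreaFormula

open scoped Function

variable {E : Type*} [NormedAddCommGroup E] [NormedSpace ℝ E] [FiniteDimensional ℝ E]
  [MeasurableSpace E] [BorelSpace E]

/-- The counting measure on the preimages of `y` under `f` at which the derivative `f'` of `f`
is invertible. -/
def regularFiber (f : E → E) (f' : E → E →L[ℝ] E) (y : E) : Measure E :=
  Measure.sum fun p : {p : E // f p = y ∧ (f' p).det ≠ 0} => Measure.dirac p.1

/-- A map that approximates an invertible linear map `A` with error constant below `‖A⁻¹‖⁻¹` is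
injective, and the regular set splits into countably many pieces with this property. -/
theorem exists_injOn_partition {f : E → E} {f' : E → E →L[ℝ] E}
    (hf : ∀ x, HasFDerivAt f (f' x) x) (hf' : Continuous f') :
    ∃ t : ℕ → Set E, Pairwise (Disjoint on t) ∧ (∀ n, MeasurableSet (t n)) ∧
      (⋃ n, t n) = {x | (f' x).det ≠ 0} ∧ ∀ n, Set.InjOn f (t n) := by
  classical
  set s : Set E := {x | (f' x).det ≠ 0} with hs
  have hsm : MeasurableSet s :=
    (isOpen_ne_fun (ContinuousLinearMap.continuous_det.comp hf') continuous_const).measurableSet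
  rcases Set.eq_empty_or_nonempty s with h0 | hne
  · refine ⟨fun _ => ∅, fun i j _ => by simp [Function.onFun], fun _ => MeasurableSet.empty,
      by simp [h0], fun n => by simp⟩
  -- Half of `‖A⁻¹‖⁻¹` makes the injectivity inequality strict. The value `1` serves only to keep
  -- `r` nonzero when the space is trivial or `A` is singular.
  let r : (E →L[ℝ] E) → NNReal := fun A => if h : A.det ≠ 0 then
    (if Subsingleton E then 1
      else ‖((A.toContinuousLinearEquivOfDetNeZero h).symm : E →L[ℝ] E)‖₊⁻¹ / 2) else 1
  have hr : ∀ A, r A ≠ 0 := by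
    intro A
    by_cases h : A.det ≠ 0
    · by_cases hE : Subsingleton E
      · simp [r, hE]
      · have : Nontrivial E := not_subsingleton_iff_nontrivial.1 hE
        have := (A.toContinuousLinearEquivOfDetNeZero h).nnnorm_symm_pos
        simp only [r, h, hE, dif_pos, if_false, ne_eq, not_false_eq_true]
        positivity
    · simp only [r, dif_neg h, ne_eq, one_ne_zero, not_false_eq_true]
  obtain ⟨t, A, h1, h2, h3, h4, h5⟩ := exists_partition_approximatesLinearOn_of_hasFDerivWithinAt
    f s f' (fun x _ => (hf x).hasFDerivWithinAt) r hr
  refine ⟨fun n => s ∩ t n, ?_, fun n => hsm.inter (h2 n), ?_, ?_⟩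
  · exact fun i j hij => (h1 hij).mono Set.inter_subset_right Set.inter_subset_right
  · rw [← Set.inter_iUnion, Set.inter_eq_left.2 h3]
  · intro n
    obtain ⟨y, hy, hA⟩ := h5 hne n
    have hd : (A n).det ≠ 0 := by rw [hA]; exact hy
    have h := h4 n
    rw [← (A n).coe_toContinuousLinearEquivOfDetNeZero hd] at h
    refine h.injOn ?_
    by_cases hE : Subsingleton E
    · exact Or.inl hE
    · right
      have : Nontrivial E := not_subsingleton_iff_nontrivial.1 hE
      have hp := ((A n).toContinuousLinearEquivOfDetNeZero hd).nnnorm_symm_pos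
      rw [ContinuousLinearMap.coe_toContinuousLinearEquivOfDetNeZero]
      simp only [r, hd, hE, dif_pos, if_false, ne_eq, not_false_eq_true]
      exact NNReal.half_lt_self (inv_ne_zero hp.ne')

/-- By injectivity each piece contains at most one point of the fibre, so counting the fibre amounts
to counting the images that contain `y`. This form makes measurability in `y` and integration
accessible. -/
theorem regularFiber_apply {f : E → E} {f' : E → E →L[ℝ] E} {t : ℕ → Set E}
    (hd : Pairwise (Disjoint on t)) (hu : (⋃ n, t n) = {x | (f' x).det ≠ 0})
    (hi : ∀ n, Set.InjOn f (t n)) {s : Set E} (hs : MeasurableSet s) (y : E) :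
    regularFiber f f' y s = ∑' n, (f '' (t n ∩ s)).indicator 1 y := by
  classical
  rw [regularFiber, Measure.sum_apply _ hs]
  have h1 : ∀ p : {p : E // f p = y ∧ (f' p).det ≠ 0},
      Measure.dirac p.1 s = ∑' n, (t n ∩ s).indicator (1 : E → ENNReal) p.1 := by
    rintro ⟨p, hp, hp'⟩
    rw [Measure.dirac_apply' _ hs]
    obtain ⟨n, hn⟩ := Set.mem_iUnion.1 (show p ∈ ⋃ n, t n by rw [hu]; exact hp')
    rw [tsum_eq_single n]
    · by_cases h : p ∈ s <;> simp [h, hn]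
    · intro m hm
      rw [Set.indicator_of_notMem]
      exact fun h => (Set.disjoint_left.1 (hd hm)) h.1 hn
  simp_rw [h1]
  rw [ENNReal.tsum_comm]
  congr 1 with n
  by_cases hy : y ∈ f '' (t n ∩ s)
  · obtain ⟨p, hp, rfl⟩ := hy
    have hp' : (f' p).det ≠ 0 := by
      have : p ∈ ⋃ n, t n := Set.mem_iUnion.2 ⟨n, hp.1⟩
      rwa [hu] at this
    rw [tsum_eq_single ⟨p, rfl, hp'⟩]
    · rw [Set.indicator_of_mem hp, Set.indicator_of_mem (Set.mem_image_of_mem f hp)]; rfl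
    · rintro ⟨q, hq, hq'⟩ hne
      rw [Set.indicator_of_notMem]
      exact fun h => hne (Subtype.ext (hi n h.1 hp.1 hq))
  · rw [Set.indicator_of_notMem hy]
    refine ENNReal.tsum_eq_zero.2 ?_
    rintro ⟨q, hq, hq'⟩
    rw [Set.indicator_of_notMem]
    exact fun h => hy ⟨q, h, hq⟩

theorem measurableSet_image_inter {f : E → E} {f' : E → E →L[ℝ] E}
    (hf : ∀ x, HasFDerivAt f (f' x) x) {t s : Set E} (ht : MeasurableSet t)
    (hi : Set.InjOn f t) (hs : MeasurableSet s) : MeasurableSet (f '' (t ∩ s)) :=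
  measurable_image_of_fderivWithin (ht.inter hs) (fun x _ => (hf x).hasFDerivWithinAt)
    (hi.mono Set.inter_subset_left)

theorem measurable_regularFiber {f : E → E} {f' : E → E →L[ℝ] E}
    (hf : ∀ x, HasFDerivAt f (f' x) x) (hf' : Continuous f') :
    Measurable (regularFiber f f') := by
  obtain ⟨t, h1, h2, h3, h4⟩ := exists_injOn_partition hf hf'
  refine Measure.measurable_of_measurable_coe _ fun s hs => ?_
  simp_rw [regularFiber_apply h1 h3 h4 hs]
  exact Measurable.tsum fun n =>
    measurable_one.indicator (measurableSet_image_inter hf (h2 n) (h4 n) hs)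

/-- The area formula, as an identity of measures. -/
theorem bind_regularFiber (μ : Measure E) [μ.IsAddHaarMeasure] {f : E → E}
    {f' : E → E →L[ℝ] E} (hf : ∀ x, HasFDerivAt f (f' x) x) (hf' : Continuous f') :
    μ.bind (regularFiber f f') = μ.withDensity fun x => ENNReal.ofReal |(f' x).det| := by
  obtain ⟨t, h1, h2, h3, h4⟩ := exists_injOn_partition hf hf'
  ext s hs
  rw [Measure.bind_apply hs (measurable_regularFiber hf hf').aemeasurable,
    withDensity_apply _ hs]
  simp_rw [regularFiber_apply h1 h3 h4 hs]
  rw [lintegral_tsum fun n => (measurable_one.indicator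
    (measurableSet_image_inter hf (h2 n) (h4 n) hs)).aemeasurable]
  have h5 : ∀ n, ∫⁻ y, (f '' (t n ∩ s)).indicator 1 y ∂μ =
      ∫⁻ x in t n ∩ s, ENNReal.ofReal |(f' x).det| ∂μ := fun n => by
    rw [lintegral_indicator_one (measurableSet_image_inter hf (h2 n) (h4 n) hs),
      lintegral_abs_det_fderiv_eq_addHaar_image μ ((h2 n).inter hs)
        (fun x _ => (hf x).hasFDerivWithinAt) ((h4 n).mono Set.inter_subset_left)]
  simp_rw [h5]
  have hdet : Measurable fun x => ENNReal.ofReal |(f' x).det| :=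
    (ContinuousLinearMap.continuous_det.comp hf').abs.measurable.ennreal_ofReal
  rw [← lintegral_iUnion (fun n => (h2 n).inter hs)
    (fun i j hij => (h1 hij).mono Set.inter_subset_left Set.inter_subset_left),
    ← Set.iUnion_inter, h3, ← lintegral_indicator hs, ← lintegral_indicator
      (.inter (h3 ▸ MeasurableSet.iUnion h2) hs)]
  congr 1 with x
  -- Critical points carry zero density, so the restriction to the regular set loses nothing.
  by_cases hx : x ∈ s <;> by_cases hx' : (f' x).det = 0 <;> simp [hx, hx']

/-- The area formula for a measure with a density. -/
theorem withDensity_bind_regularFiber (μ : Measure E) [μ.IsAddHaarMeasure] {f : E → E}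
    {f' : E → E →L[ℝ] E} (hf : ∀ x, HasFDerivAt f (f' x) x) (hf' : Continuous f')
    {ρ : E → ENNReal} (hρ : Measurable ρ) :
    (μ.withDensity ρ).bind (regularFiber f f') =
      μ.withDensity fun x => ρ (f x) * ENNReal.ofReal |(f' x).det| := by
  have hm := measurable_regularFiber hf hf'
  have hfm : Measurable f :=
    (continuous_iff_continuousAt.2 fun x => (hf x).continuousAt).measurable
  have hdet : Measurable fun x => ENNReal.ofReal |(f' x).det| :=
    (ContinuousLinearMap.continuous_det.comp hf').abs.measurable.ennreal_ofReal
  ext s hs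
  rw [Measure.bind_apply hs hm.aemeasurable, lintegral_withDensity_eq_lintegral_mul _ hρ
    (show Measurable fun y => regularFiber f f' y s from (Measure.measurable_coe hs).comp hm), withDensity_apply _ hs]
  -- On the fibre over `y` one has `f x = y`, so `ρ y` moves inside as `ρ (f x)`.
  have h1 : ∀ y, (ρ * fun y => regularFiber f f' y s) y =
      ∫⁻ x, s.indicator (fun x => ρ (f x)) x ∂(regularFiber f f' y) := fun y => by
    have hm' : Measurable (s.indicator fun x => ρ (f x)) := (hρ.comp hfm).indicator hs
    rw [Pi.mul_apply, regularFiber, lintegral_sum_measure, Measure.sum_apply _ hs,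
      ← ENNReal.tsum_mul_left]
    congr 1 with p
    rw [lintegral_dirac' _ hm', Measure.dirac_apply' _ hs]
    by_cases hp : p.1 ∈ s <;> simp [hp, p.2.1]
  have h2 : Measurable (s.indicator fun x => ρ (f x)) := (hρ.comp hfm).indicator hs
  simp_rw [h1]
  rw [← Measure.lintegral_bind hm.aemeasurable h2.aemeasurable,
    bind_regularFiber μ hf hf', lintegral_withDensity_eq_lintegral_mul _ hdet h2, ← lintegral_indicator hs]
  congr 1 with x
  by_cases hx : x ∈ s <;> simp [hx, mul_comm]

end AreaFormula

end DeformedGinibre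

namespace DeformedGinibre

/-! ### Determinants of block triangular maps -/

section Shear

variable {K V W : Type*} [Field K] [CharZero K] [AddCommGroup V] [Module K V]
  [AddCommGroup W] [Module K W]

/-- Conjugation by `diag(2, 1)` turns the shear by `f` into the shear by `2f`, which is its square.
Hence the determinant `d` satisfies `d = d²`, and `d ≠ 0` because the shear by `-f` is an inverse.
-/
theorem det_shear (f : W →ₗ[K] V) :
    (((LinearMap.id : V →ₗ[K] V).coprod f).prod (LinearMap.snd K V W)).det = 1 := by
  set S : (W →ₗ[K] V) → (V × W →ₗ[K] V × W) :=
    fun f => ((LinearMap.id : V →ₗ[K] V).coprod f).prod (LinearMap.snd K V W) with hS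
  have hmul : ∀ f g, (S f).comp (S g) = S (f + g) := fun f g => by
    ext x <;> simp [hS, add_comm]
  have h0 : S 0 = LinearMap.id := by ext x <;> simp [hS]
  have hu : (S f).det ≠ 0 := fun h => by
    have := congrArg LinearMap.det (hmul f (-f))
    rw [LinearMap.det_comp, h, add_neg_cancel, h0, LinearMap.det_id, zero_mul] at this
    exact zero_ne_one this
  let D : (V × W) ≃ₗ[K] (V × W) :=
    (LinearEquiv.smulOfNeZero K V (2 : K) two_ne_zero).prodCongr (LinearEquiv.refl K W)
  have hc : (D : V × W →ₗ[K] V × W) ∘ₗ S f ∘ₗ (D.symm : V × W →ₗ[K] V × W) = S (f + f) := by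
    have hD : (D : V × W →ₗ[K] V × W) ∘ₗ S f = S (f + f) ∘ₗ (D : V × W →ₗ[K] V × W) := by
      ext x <;> simp [hS, D, two_smul]
    rw [← LinearMap.comp_assoc, hD, LinearMap.comp_assoc]
    simp
  have h1 := LinearMap.det_conj (S f) D
  rw [hc, ← hmul, LinearMap.det_comp] at h1
  exact mul_left_cancel₀ hu (h1.trans (mul_one _).symm)

theorem det_coprod_prod_snd [FiniteDimensional K V] [FiniteDimensional K W] (g : V →ₗ[K] V) (f : W →ₗ[K] V) :
    ((g.coprod f).prod (LinearMap.snd K V W)).det = g.det := by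
  have h : (g.coprod f).prod (LinearMap.snd K V W) =
      (((LinearMap.id : V →ₗ[K] V).coprod f).prod (LinearMap.snd K V W)).comp
        (g.prodMap LinearMap.id) := by
    ext x <;> simp
  rw [h, LinearMap.det_comp, det_shear, LinearMap.det_prodMap, LinearMap.det_id, one_mul, mul_one]

end Shear

/-! ### The derivative of the characteristic polynomial at an eigenvalue -/

section Charpoly

open Polynomial

variable {R : Type*} [CommRing R] {m : Type*} [Fintype m] [DecidableEq m]

/-- Cramer's rule for the characteristic matrix: it sends `v` to `(T - z) v`, with `T` the
polynomial variable, and the coordinate `i` of `v` is `1`. No division is needed, so any commutative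
ring will do. -/
theorem charpoly_eq_mul_of_mulVec_eq_smul {X : Matrix m m R} {z : R} {v : m → R} {i : m}
    (hv : v i = 1) (h : X.mulVec v = z • v) :
    X.charpoly = (Polynomial.X - C z) * (X.charmatrix.updateCol i (C ∘ v)).det := by
  have h1 : X.charmatrix.mulVec (C ∘ v) = (Polynomial.X - C z) • (C ∘ v) := by
    have h2 : (X.map C).mulVec (C ∘ v) = C ∘ (X.mulVec v) := by
      ext1 k
      exact (RingHom.map_mulVec C X v k).symm
    rw [Matrix.charmatrix, Matrix.sub_mulVec]
    change _ - (X.map C).mulVec (C ∘ v) = _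
    rw [h2, h]
    ext1 k
    simp [Matrix.scalar_apply, sub_mul]
  have h3 : X.charmatrix.cramer (X.charmatrix.mulVec (C ∘ v)) = X.charpoly • (C ∘ v) := by
    rw [Matrix.cramer_eq_adjugate_mulVec, Matrix.mulVec_mulVec, Matrix.adjugate_mul,
      Matrix.smul_mulVec, Matrix.one_mulVec, Matrix.charpoly]
  rw [h1, map_smul] at h3
  have h4 := congrFun h3 i
  rw [Pi.smul_apply, Pi.smul_apply, Matrix.cramer_apply] at h4
  simp only [Function.comp_apply, hv, map_one, smul_eq_mul, mul_one] at h4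
  exact h4.symm

theorem eval_derivative_charpoly {X : Matrix m m R} {z : R} {v : m → R} {i : m}
    (hv : v i = 1) (h : X.mulVec v = z • v) :
    X.charpoly.derivative.eval z = ((Matrix.scalar m z - X).updateCol i v).det := by
  rw [charpoly_eq_mul_of_mulVec_eq_smul hv h, derivative_mul]
  simp only [derivative_sub, derivative_X, derivative_C, sub_zero, one_mul, eval_add, eval_mul,
    eval_sub, eval_X, eval_C, sub_self, zero_mul, add_zero]
  rw [← coe_evalRingHom, RingHom.map_det]
  congr 1
  ext k l
  rcases eq_or_ne l i with rfl | hl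
  · simp
  · rcases eq_or_ne k l with rfl | hk
    · simp [hl, Matrix.charmatrix]
    · simp [hl, Matrix.charmatrix, hk]

end Charpoly

/-! ### Eigenpair coordinates on matrices and their Jacobian -/

section Chart

variable {n : ℕ}

/-- Coordinates on matrices of size `n + 1`: the first column and the other columns. -/
abbrev Par (n : ℕ) : Type := (Fin (n + 1) → ℂ) × (Fin (n + 1) → Fin n → ℂ)

/-- The matrix with given first column and other columns. -/
def toMat (p : Par n) : Matrix (Fin (n + 1)) (Fin (n + 1)) ℂ :=
  Matrix.of fun i => Fin.cons (p.1 i) (p.2 i)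

@[simp] theorem toMat_zero (p : Par n) (i : Fin (n + 1)) : toMat p i 0 = p.1 i := rfl

@[simp] theorem toMat_succ (p : Par n) (i : Fin (n + 1)) (j : Fin n) :
    toMat p i j.succ = p.2 i j := rfl

/-- The vector with first entry `1` and the same other entries as `c`. -/
def chartVec (c : Fin (n + 1) → ℂ) : Fin (n + 1) → ℂ := Fin.cons 1 fun j => c j.succ

@[simp] theorem chartVec_zero (c : Fin (n + 1) → ℂ) : chartVec c 0 = 1 := rfl

@[simp] theorem chartVec_succ (c : Fin (n + 1) → ℂ) (j : Fin n) :
    chartVec c j.succ = c j.succ := rfl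

/-- The coordinates of the matrix with eigenvalue `p.1 0`, eigenvector `chartVec p.1` and last
columns `p.2`. -/
def chart (p : Par n) : Par n :=
  (fun i => p.1 0 * chartVec p.1 i - ∑ j, p.2 i j * p.1 j.succ, p.2)

@[simp] theorem chart_snd (p : Par n) : (chart p).2 = p.2 := rfl

theorem toMat_chart_mulVec (p : Par n) :
    (toMat (chart p)).mulVec (chartVec p.1) = p.1 0 • chartVec p.1 := by
  ext i
  simp [Matrix.mulVec, dotProduct, Fin.sum_univ_succ, chart]

/-- This identifies the fibre of `chart` over a matrix with the set of its eigenpairs normalised by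
first entry `1`. -/
theorem chart_eq_iff {p y : Par n} :
    chart p = y ↔ p.2 = y.2 ∧ (toMat y).mulVec (chartVec p.1) = p.1 0 • chartVec p.1 := by
  constructor
  · rintro rfl
    exact ⟨rfl, toMat_chart_mulVec p⟩
  · rintro ⟨h1, h2⟩
    refine Prod.ext ?_ h1
    ext i
    have := congrFun h2 i
    simp only [Matrix.mulVec, dotProduct, Fin.sum_univ_succ, toMat_zero, toMat_succ,
      chartVec_zero, chartVec_succ, mul_one, Pi.smul_apply, smul_eq_mul] at this
    simp only [chart, h1]
    rw [← this]
    ring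

/-- The derivative of `chart`, along the first column. -/
def chartDerivMatrix (p : Par n) : Matrix (Fin (n + 1)) (Fin (n + 1)) ℂ :=
  (Matrix.scalar _ (p.1 0) - toMat (chart p)).updateCol 0 (chartVec p.1)

/-- Differentiating in the eigenvalue gives the eigenvector as column `0`, and differentiating in an
eigenvector coordinate gives the corresponding column of `z - X`. This is the matrix of the Cramer
identity. -/
theorem det_chartDerivMatrix (p : Par n) :
    (chartDerivMatrix p).det = (toMat (chart p)).charpoly.derivative.eval (p.1 0) :=
  (eval_derivative_charpoly (chartVec_zero p.1) (toMat_chart_mulVec p)).symm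

/-- The derivative of `chart`, as a complex linear map. -/
def chartDeriv (p : Par n) : Par n →ₗ[ℂ] Par n :=
  ((Matrix.toLin' (chartDerivMatrix p)).coprod
    (LinearMap.pi fun i => -∑ j, p.1 j.succ • (LinearMap.proj j ∘ₗ LinearMap.proj i))).prod
    (LinearMap.snd ℂ _ _)

theorem det_chartDeriv (p : Par n) : (chartDeriv p).det = (chartDerivMatrix p).det := by
  rw [chartDeriv, det_coprod_prod_snd, LinearMap.det_toLin']

theorem chartVec_apply (c : Fin (n + 1) → ℂ) (i : Fin (n + 1)) :
    chartVec c i = if i = 0 then 1 else c i := by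
  refine Fin.cases ?_ (fun j => ?_) i <;> simp [Fin.succ_ne_zero]

theorem hasFDerivAt_chart (p : Par n) :
    HasFDerivAt (𝕜 := ℂ) chart (LinearMap.toContinuousLinearMap (chartDeriv p)) p := by
  have h1 : ∀ k, HasFDerivAt (𝕜 := ℂ) (fun p : Par n => p.1 k)
      (ContinuousLinearMap.proj k ∘L ContinuousLinearMap.fst ℂ _ _) p := fun k =>
    (ContinuousLinearMap.proj (R := ℂ) (φ := fun _ : Fin (n + 1) => ℂ) k ∘L
      ContinuousLinearMap.fst ℂ _ (Fin (n + 1) → Fin n → ℂ)).hasFDerivAt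
  have h2 : ∀ i j, HasFDerivAt (𝕜 := ℂ) (fun p : Par n => p.2 i j)
      (ContinuousLinearMap.proj j ∘L ContinuousLinearMap.proj i ∘L
        ContinuousLinearMap.snd ℂ _ _) p := fun i j =>
    (ContinuousLinearMap.proj (R := ℂ) (φ := fun _ : Fin n => ℂ) j ∘L
      ContinuousLinearMap.proj (R := ℂ) (φ := fun _ : Fin (n + 1) => Fin n → ℂ) i ∘L
        ContinuousLinearMap.snd ℂ (Fin (n + 1) → ℂ) _).hasFDerivAt
  have h3 : ∀ i, HasFDerivAt (𝕜 := ℂ) (fun p : Par n => chartVec p.1 i)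
      (if i = 0 then 0 else ContinuousLinearMap.proj i ∘L ContinuousLinearMap.fst ℂ _ _) p := by
    intro i
    simp_rw [chartVec_apply]
    split_ifs with hi
    · exact hasFDerivAt_const _ _
    · exact h1 i
  have h4 := (hasFDerivAt_pi.2 fun i => ((h1 0).mul (h3 i)).sub
    (HasFDerivAt.fun_sum (u := Finset.univ) fun j _ => (h2 i j).mul (h1 (Fin.succ j)))).prodMk
      (hasFDerivAt_snd (𝕜 := ℂ) (p := p))
  refine h4.congr_fderiv ?_
  refine ContinuousLinearMap.ext fun w => Prod.ext (funext fun i => ?_) ?_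
  · simp [chartDeriv, chartDerivMatrix, Matrix.mulVec, dotProduct, Fin.sum_univ_succ,
      Matrix.diagonal_apply]
    refine Fin.cases ?_ (fun k => ?_) i
    · simp [Finset.sum_add_distrib, (Fin.succ_ne_zero _).symm]
      ring
    · simp [Finset.sum_add_distrib, sub_mul, Finset.sum_sub_distrib]
      ring_nf
  · simp [chartDeriv]

theorem differentiable_chart : Differentiable ℝ (chart (n := n)) := fun p =>
  ((hasFDerivAt_chart p).restrictScalars ℝ).differentiableAt

theorem continuous_fderiv_chart : Continuous (fderiv ℝ (chart (n := n))) := by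
  refine ContDiff.continuous_fderiv (n := 1) ?_ one_ne_zero
  refine (contDiff_pi.2 fun i => ?_).prodMk contDiff_snd
  refine Fin.cases ?_ (fun k => ?_) i
  · simp only [chartVec_zero]
    fun_prop
  · simp only [chartVec_succ]
    fun_prop

/-- The chart is holomorphic, and the real determinant of a complex linear map is the squared
modulus of its complex determinant. That one is block triangular, since the last columns are
preserved. -/
theorem abs_det_fderiv_chart (p : Par n) :
    |(fderiv ℝ chart p).det| =
      ‖(toMat (chart p)).charpoly.derivative.eval (p.1 0)‖ ^ 2 := by
  rw [((hasFDerivAt_chart p).restrictScalars ℝ).fderiv, ← det_chartDerivMatrix, ← det_chartDeriv]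
  change |((chartDeriv p).restrictScalars ℝ).det| = _
  rw [LinearMap.det_restrictScalars, Algebra.norm_complex_apply, Complex.normSq_eq_norm_sq,
    abs_of_nonneg (sq_nonneg _)]

end Chart

end DeformedGinibre

namespace DeformedGinibre

/-! ### Phase averages of unit vectors -/

section Phase

variable {N : ℕ} [NeZero N]

theorem coe_withPhase {v : CSphere N} (hv : (v : CVec N) 0 ≠ 0) (θ : ℝ) :
    (withPhase v θ : CVec N) =
      (Complex.exp (θ * Complex.I) * (‖(v : CVec N) 0‖ / (v : CVec N) 0)) • (v : CVec N) := by
  have h := Complex.norm_mul_exp_arg_mul_I ((v : CVec N) 0)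
  have h1 : ((‖(v : CVec N) 0‖ : ℝ) : ℂ) ≠ 0 := by simpa using hv
  have h2 : (‖(v : CVec N) 0‖ : ℂ) / (v : CVec N) 0 =
      Complex.exp (-(Complex.arg ((v : CVec N) 0) * Complex.I)) := by
    rw [Complex.exp_neg, div_eq_iff hv]
    nth_rw 3 [← h]
    rw [mul_comm, mul_assoc, mul_inv_cancel₀ (Complex.exp_ne_zero _), mul_one]
  rw [h2, ← Complex.exp_add, withPhase]
  push_cast
  ring_nf

/-- Fixing the phase of the first entry cancels `α`, which has modulus one. This makes the phase
average independent of the eigenvector chosen in `eigenpairMeasure`. It needs a nonzero first entry,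
since `Complex.arg 0` is a convention. -/
theorem withPhase_eq_of_smul {v w : CSphere N} {α : ℂ} (h : (w : CVec N) = α • (v : CVec N))
    (hw : (w : CVec N) 0 ≠ 0) (θ : ℝ) : withPhase w θ = withPhase v θ := by
  have h0 : (w : CVec N) 0 = α * (v : CVec N) 0 := by rw [h]; rfl
  have hv : (v : CVec N) 0 ≠ 0 := fun hv => hw (by rw [h0, hv, mul_zero])
  have hα : α ≠ 0 := fun hα => hw (by rw [h0, hα, zero_mul])
  have hn : ‖α‖ = 1 := by
    have h1 : ‖(w : CVec N)‖ = 1 := by simp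
    have h2 : ‖(v : CVec N)‖ = 1 := by simp
    rwa [h, norm_smul, h2, mul_one] at h1
  refine Subtype.ext ?_
  rw [coe_withPhase hw, coe_withPhase hv, h0, h, smul_smul, norm_mul, hn, one_mul]
  congr 1
  field_simp

theorem phaseAverage_eq_of_smul {v w : CSphere N} {α : ℂ} (h : (w : CVec N) = α • (v : CVec N))
    (hw : (w : CVec N) 0 ≠ 0) (z : ℂ) : phaseAverage z w = phaseAverage z v := by
  simp_rw [phaseAverage, withPhase_eq_of_smul h hw]

theorem measurable_withPhase : Measurable fun q : CSphere N × ℝ => withPhase q.1 q.2 := by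
  refine Measurable.subtype_mk ?_
  have h0 : Measurable fun q : CSphere N × ℝ => (q.1 : CVec N) 0 :=
    (EuclideanSpace.proj (𝕜 := ℂ) (0 : Fin N)).continuous.measurable.comp
      (measurable_subtype_coe.comp measurable_fst)
  exact ((Complex.measurable_exp.comp ((Complex.measurable_ofReal.comp
    (measurable_snd.sub (Complex.measurable_arg.comp h0))).mul_const _))).smul
      (measurable_subtype_coe.comp measurable_fst)

theorem phaseAverage_apply (z : ℂ) (v : CSphere N) {s : Set (ℂ × CSphere N)}
    (hs : MeasurableSet s) :
    phaseAverage z v s = (ENNReal.ofReal (2 * Real.pi))⁻¹ *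
      ∫⁻ θ in Set.Ico 0 (2 * Real.pi), s.indicator 1 (z, withPhase v θ) := by
  have hm : Measurable fun θ : ℝ => (z, withPhase v θ) :=
    measurable_const.prodMk (measurable_withPhase.comp (measurable_const.prodMk measurable_id))
  rw [phaseAverage, Measure.smul_apply, smul_eq_mul, ← lintegral_indicator_one hs,
    lintegral_map (measurable_one.indicator hs) hm]

theorem measurable_prodMk_withPhase :
    Measurable fun q : (ℂ × CSphere N) × ℝ => (q.1.1, withPhase q.1.2 q.2) := by
  have h1 : Measurable fun q : (ℂ × CSphere N) × ℝ => (q.1.2, q.2) :=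
    (measurable_snd.comp measurable_fst).prodMk measurable_snd
  have h := (measurable_withPhase (N := N)).comp h1
  exact (measurable_fst.comp measurable_fst).prodMk h

theorem measurable_lintegral_withPhase {g : ℂ × CSphere N → ENNReal} (hg : Measurable g) :
    Measurable fun q : ℂ × CSphere N =>
      ∫⁻ θ in Set.Ico 0 (2 * Real.pi), g (q.1, withPhase q.2 θ) := by
  exact (hg.comp measurable_prodMk_withPhase).lintegral_prod_right'
    (ν := volume.restrict (Set.Ico 0 (2 * Real.pi)))

theorem measurable_phaseAverage :
    Measurable fun q : ℂ × CSphere N => phaseAverage q.1 q.2 := by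
  refine Measure.measurable_of_measurable_coe _ fun s hs => ?_
  have h := (measurable_lintegral_withPhase (measurable_one.indicator hs)).const_mul
    (ENNReal.ofReal (2 * Real.pi))⁻¹
  have e : (fun q : ℂ × CSphere N => phaseAverage q.1 q.2 s) = _ :=
    funext fun q => phaseAverage_apply q.1 q.2 hs
  rw [e]
  exact h
end Phase

variable {n : ℕ}

/-! ### Unit vectors from affine coordinates -/

section ChartSphere

theorem toLp_chartVec_ne_zero (c : Fin (n + 1) → ℂ) :
    (WithLp.toLp 2 (chartVec c) : CVec (n + 1)) ≠ 0 := fun h => by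
  have := congrArg (fun w : CVec (n + 1) => w 0) h
  simp at this

/-- The normalisation of `chartVec c`. -/
def chartSphere (c : Fin (n + 1) → ℂ) : CSphere (n + 1) :=
  ⟨((‖(WithLp.toLp 2 (chartVec c) : CVec (n + 1))‖⁻¹ : ℝ) : ℂ) • WithLp.toLp 2 (chartVec c), by
    rw [mem_sphere_zero_iff_norm, norm_smul, Complex.norm_real, norm_inv, norm_norm,
      inv_mul_cancel₀ (norm_ne_zero_iff.2 (toLp_chartVec_ne_zero c))]⟩

theorem chartSphere_zero_ne_zero (c : Fin (n + 1) → ℂ) :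
    (chartSphere c : CVec (n + 1)) 0 ≠ 0 := by
  have h := toLp_chartVec_ne_zero c
  simpa [chartSphere] using h

theorem continuous_chartVec : Continuous (chartVec (n := n)) := by
  refine continuous_pi fun i => ?_
  refine Fin.cases ?_ (fun j => ?_) i
  · simpa using continuous_const
  · simpa using continuous_apply _

theorem measurable_chartSphere : Measurable (chartSphere (n := n)) := by
  refine Measurable.subtype_mk ?_
  have h : Measurable fun c : Fin (n + 1) → ℂ =>
      (WithLp.toLp 2 (chartVec c) : CVec (n + 1)) :=
    ((PiLp.continuous_toLp 2 _).comp continuous_chartVec).measurable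
  exact (Complex.measurable_ofReal.comp h.norm.inv).smul h

theorem measurable_phaseAverage_chartSphere :
    Measurable fun p : Par n => phaseAverage (p.1 0) (chartSphere p.1) :=
  measurable_phaseAverage.comp (((measurable_pi_apply 0).comp measurable_fst).prodMk
    (measurable_chartSphere.comp measurable_fst))

end ChartSphere

/-! ### The empirical measure of a generic matrix as a sum over a fibre -/

section Generic

/-- The empirical measure of a matrix all of whose eigenvectors have a nonzero first entry, and
which is a regular value of `chart`. -/
theorem empiricalMeasure_toMat {y : Par n}
    (h1 : ∀ (z : ℂ) (w : Fin (n + 1) → ℂ), (toMat y).mulVec w = z • w → w 0 = 0 → w = 0)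
    (h2 : y ∉ chart '' {p | (fderiv ℝ chart p).det = 0}) :
    empiricalMeasure (toMat y) = (regularFiber chart (fderiv ℝ chart) y).bind
      fun p => phaseAverage (p.1 0) (chartSphere p.1) := by
  classical
  set X := toMat y with hX
  have hne : X.charpoly ≠ 0 := X.charpoly_monic.ne_zero
  have hroot : ∀ p : Par n, chart p = y → p.1 0 ∈ X.charpoly.roots := by
    intro p hp
    rw [Polynomial.mem_roots hne, Polynomial.IsRoot,
      charpoly_eq_mul_of_mulVec_eq_smul (chartVec_zero p.1) (chart_eq_iff.1 hp).2]
    simp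
  have hlift : ∀ z ∈ X.charpoly.roots, ∃ p : Par n, p.1 0 = z ∧ chart p = y ∧
      (fderiv ℝ chart p).det ≠ 0 := by
    intro z hz
    rw [Polynomial.mem_roots hne, ← Matrix.mem_spectrum_iff_isRoot_charpoly,
      ← Matrix.spectrum_toLin', ← Module.End.hasEigenvalue_iff_mem_spectrum] at hz
    obtain ⟨w, hw⟩ := hz.exists_hasEigenvector
    have hw1 : X.mulVec w = z • w := by simpa using hw.apply_eq_smul
    have hw0 : w 0 ≠ 0 := fun h => hw.2 (h1 z w hw1 h)
    let p : Par n := (Fin.cons z fun j => (w 0)⁻¹ * w j.succ, y.2)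
    have hc : chartVec p.1 = (w 0)⁻¹ • w := by
      ext i
      refine Fin.cases ?_ (fun j => ?_) i
      · simp [hw0]
      · simp [p]
    have hp : chart p = y := by
      refine chart_eq_iff.2 ⟨rfl, ?_⟩
      rw [hc, Matrix.mulVec_smul, ← hX, hw1, smul_comm]
      rfl
    exact ⟨p, rfl, hp, fun hd => h2 ⟨p, hd, hp⟩⟩
  -- At a multiple root the derivative of the characteristic polynomial vanishes. So does the
  -- Jacobian at the corresponding preimage, against the regularity of `y`.
  have hnodup : X.charpoly.roots.Nodup := by
    rw [Multiset.nodup_iff_count_le_one]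
    intro z
    rw [Polynomial.count_roots]
    by_contra! hlt
    rw [Polynomial.one_lt_rootMultiplicity_iff_isRoot hne] at hlt
    obtain ⟨p, hpz, hp, hd⟩ := hlift z ((Polynomial.mem_roots hne).2 hlt.1)
    refine hd ?_
    have h3 := abs_det_fderiv_chart p
    rw [hp, ← hX, hpz, hlt.2.eq_zero] at h3
    simpa using h3
  -- The fibre is in bijection with the eigenvalues: two normalised eigenvectors for one eigenvalue
  -- differ by a vector satisfying the eigenvector equation with first entry zero, which vanishes by
  -- `h1`.
  let e : {p : Par n // chart p = y ∧ (fderiv ℝ chart p).det ≠ 0} → X.charpoly.roots.toFinset :=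
    fun p => ⟨p.1.1 0, Multiset.mem_toFinset.2 (hroot p.1 p.2.1)⟩
  have he : Function.Bijective e := by
    constructor
    · rintro ⟨p, hp, hp'⟩ ⟨q, hq, hq'⟩ hpq
      have h0 : p.1 0 = q.1 0 := congrArg Subtype.val hpq
      have hv : chartVec p.1 - chartVec q.1 = 0 := by
        refine h1 (p.1 0) _ ?_ (by simp)
        rw [Matrix.mulVec_sub, (chart_eq_iff.1 hp).2, (chart_eq_iff.1 hq).2, h0, smul_sub]
      refine Subtype.ext (Prod.ext ?_ ((chart_eq_iff.1 hp).1.trans (chart_eq_iff.1 hq).1.symm))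
      ext i
      refine Fin.cases h0 (fun j => ?_) i
      simpa [sub_eq_zero] using congrFun hv j.succ
    · rintro ⟨z, hz⟩
      obtain ⟨p, hpz, hp, hd⟩ := hlift z (Multiset.mem_toFinset.1 hz)
      exact ⟨⟨p, hp, hd⟩, Subtype.ext hpz⟩
  have hpair : ∀ p : {p : Par n // chart p = y ∧ (fderiv ℝ chart p).det ≠ 0},
      eigenpairMeasure X (e p) = phaseAverage (p.1.1 0) (chartSphere p.1.1) := by
    rintro ⟨p, hp, hp'⟩
    have hE : IsUnitEigenvector X (p.1 0) (chartSphere p.1) := by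
      rw [IsUnitEigenvector, chartSphere]
      simp only [WithLp.ofLp_smul]
      rw [Matrix.mulVec_smul, (chart_eq_iff.1 hp).2, smul_comm]
    have hex : ∃ v, IsUnitEigenvector X (p.1 0) v := ⟨_, hE⟩
    change eigenpairMeasure X (p.1 0) = _
    rw [eigenpairMeasure, dif_pos hex]
    set v := hex.choose with hv
    have hv1 : IsUnitEigenvector X (p.1 0) v := hex.choose_spec
    have hvn : (v : CVec (n + 1)) ≠ 0 := ne_zero_of_mem_unit_sphere v
    have hv0 : (v : CVec (n + 1)) 0 ≠ 0 := fun h =>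
      hvn ((WithLp.ofLp_eq_zero 2).1 (h1 _ _ hv1 h))
    have hw0 := chartSphere_zero_ne_zero p.1
    refine phaseAverage_eq_of_smul
      (α := (v : CVec (n + 1)) 0 / (chartSphere p.1 : CVec (n + 1)) 0) ?_ hv0 _
    -- The multiple of the chart vector is chosen to cancel the first entry of `v`, so `h1` forces
    -- the difference to vanish.
    have hsub := h1 (p.1 0) ((v : CVec (n + 1)).ofLp -
      ((v : CVec (n + 1)) 0 / (chartSphere p.1 : CVec (n + 1)) 0) •
        (chartSphere p.1 : CVec (n + 1)).ofLp) ?_ ?_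
    · exact WithLp.ofLp_injective 2 (sub_eq_zero.1 hsub)
    · rw [Matrix.mulVec_sub, Matrix.mulVec_smul, hv1, hE, smul_sub, smul_comm]
    · simp [hw0]
  rw [regularFiber, Measure.bind_sum _ _ measurable_phaseAverage_chartSphere.aemeasurable]
  simp_rw [Measure.dirac_bind measurable_phaseAverage_chartSphere, ← hpair]
  ext s hs
  have hsum := (Equiv.ofBijective e he).tsum_eq (fun z : X.charpoly.roots.toFinset =>
    eigenpairMeasure X z s)
  simp only [Equiv.ofBijective_apply] at hsum
  rw [Measure.sum_apply _ hs, hsum, Finset.tsum_subtype X.charpoly.roots.toFinset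
      (fun z => eigenpairMeasure X z s), empiricalMeasure, ← Measure.finsetSum_apply]
  congr 1
  rw [Finset.sum, Multiset.toFinset_val, hnodup.dedup]

end Generic

end DeformedGinibre

namespace DeformedGinibre

section Haar

instance isAddHaarMeasure_volume_pi_pi (m n : ℕ) :
    (volume : Measure (Fin m → Fin n → ℂ)).IsAddHaarMeasure :=
  Measure.pi.isAddHaarMeasure _

instance isAddHaarMeasure_volume_par (n : ℕ) : (volume : Measure (Par n)).IsAddHaarMeasure :=
  Measure.prod.instIsAddHaarMeasure _ _

end Haar

/-! ### Almost no matrix has an eigenvector with vanishing first entry -/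

section Pivot

variable {N : ℕ}

/-- The matrix with eigenvalue `M j j`, whose eigenvector is the column `j` of `M` with its entry
`j` replaced by `1`, and whose columns other than `j` are those of `M`. -/
def pivotChart (j : Fin N) (M : Fin N → Fin N → ℂ) : Fin N → Fin N → ℂ := fun i k =>
  if k = j then (M j j * if i = j then 1 else M i j) - ∑ l, (if l = j then 0 else M i l * M l j)
  else M i k

theorem differentiable_pivotChart (j : Fin N) : Differentiable ℝ (pivotChart j) := by
  refine differentiable_pi.2 fun i => differentiable_pi.2 fun k => ?_
  unfold pivotChart
  by_cases hk : k = j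
  · simp only [hk, if_true]
    refine Differentiable.sub ?_ (Differentiable.fun_sum fun l _ => ?_)
    · split_ifs <;> fun_prop
    · split_ifs <;> fun_prop
  · simp only [hk, if_false]
    fun_prop

/-- If `w 0 = 0` and `w j ≠ 0`, normalising by the entry `j` places `X` in the image under
`pivotChart j` of the proper subspace `M 0 j = 0`. A differentiable map of a space to itself
preserves null sets, and there are finitely many `j`. -/
theorem ae_first_entry_ne_zero [NeZero N] : ∀ᵐ X : Fin N → Fin N → ℂ, ∀ (z : ℂ) (w : Fin N → ℂ),
    (Matrix.of X).mulVec w = z • w → w 0 = 0 → w = 0 := by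
  have hnull : ∀ j : Fin N, j ≠ 0 →
      (volume : Measure (Fin N → Fin N → ℂ)) (pivotChart j '' {M | M 0 j = 0}) = 0 := by
    intro j hj
    refine addHaar_image_eq_zero_of_differentiableOn_of_addHaar_eq_zero _
      (differentiable_pivotChart j).differentiableOn ?_
    let φ : (Fin N → Fin N → ℂ) →ₗ[ℝ] ℂ := LinearMap.proj j ∘ₗ LinearMap.proj 0
    refine Measure.addHaar_submodule volume φ.ker fun h => ?_
    have h1 : (fun _ _ => 1 : Fin N → Fin N → ℂ) ∈ φ.ker := h ▸ Submodule.mem_top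
    exact one_ne_zero h1
  have hall : ∀ᵐ X : Fin N → Fin N → ℂ, ∀ j : Fin N, j ≠ 0 →
      X ∉ pivotChart j '' {M | M 0 j = 0} := by
    refine ae_all_iff.2 fun j => ?_
    by_cases hj : j = 0
    · simp [hj]
    · filter_upwards [measure_eq_zero_iff_ae_notMem.1 (hnull j hj)] with X hX _ using hX
  filter_upwards [hall] with X hX z w hw hw0
  by_contra hne
  obtain ⟨j, hj⟩ := Function.ne_iff.1 hne
  simp only [Pi.zero_apply] at hj
  have hj0 : j ≠ 0 := fun h => hj (h ▸ hw0)
  refine hX j hj0 ⟨fun i k => if k = j then (if i = j then z else w i / w j) else X i k, ?_, ?_⟩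
  · simp [hj0.symm, hw0]
  · ext i k
    unfold pivotChart
    by_cases hk : k = j
    · subst hk
      have h1 := congrFun hw i
      simp only [Matrix.mulVec, dotProduct, Matrix.of_apply, Pi.smul_apply, smul_eq_mul] at h1
      rw [← Finset.add_sum_erase _ _ (Finset.mem_univ k)] at h1
      rw [← Finset.add_sum_erase _ _ (Finset.mem_univ k)]
      have h2 : ∀ l ∈ Finset.univ.erase k,
          (if l = k then (0 : ℂ) else (if l = k then (if i = k then z else w i / w k) else X i l) *
            (if k = k then (if l = k then z else w l / w k) else X l k)) = X i l * w l / w k := by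
        intro l hl
        simp [Finset.ne_of_mem_erase hl, mul_div_assoc]
      rw [Finset.sum_congr rfl h2, ← Finset.sum_div]
      by_cases hi : i = k
      · simp only [hi, if_true] at h1 ⊢
        field_simp
        linear_combination -h1
      · simp only [hi, if_true, if_false]
        field_simp
        linear_combination -h1
    · simp [hk]

end Pivot

variable {n : ℕ}

/-! ### Passage from Ginibre matrices to eigenpair coordinates -/

section ParEquiv

/-- `toMat` as a measurable equivalence. -/
def parEquiv (n : ℕ) : Par n ≃ᵐ (Fin (n + 1) → Fin (n + 1) → ℂ) :=
  (MeasurableEquiv.arrowProdEquivProdArrow ℂ (Fin n → ℂ) (Fin (n + 1))).symm.trans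
    (MeasurableEquiv.piCongrRight fun _ =>
      (MeasurableEquiv.piFinSuccAbove (fun _ : Fin (n + 1) => ℂ) 0).symm)

theorem parEquiv_apply (p : Par n) : parEquiv n p = toMat p := by
  ext1 i
  change Fin.insertNth (α := fun _ => ℂ) 0 (p.1 i) (p.2 i) =
    Fin.cons (α := fun _ => ℂ) (p.1 i) (p.2 i)
  exact Fin.insertNth_zero' _ _

theorem measurePreserving_parEquiv : MeasurePreserving (parEquiv n) volume volume := by
  have h1 := (volume_measurePreserving_arrowProdEquivProdArrow ℂ (Fin n → ℂ) (Fin (n + 1))).symm _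
  have h2 := volume_preserving_pi fun _ : Fin (n + 1) =>
      (volume_preserving_piFinSuccAbove (fun _ : Fin (n + 1) => ℂ) 0).symm _
  exact h2.comp h1

end ParEquiv

/-- Critical values form a null set by Sard's theorem, and the exceptional matrices of
`ae_first_entry_ne_zero` do too. -/
theorem ae_empiricalMeasure_toMat : ∀ᵐ y : Par n,
    empiricalMeasure (toMat y) = (regularFiber chart (fderiv ℝ chart) y).bind
      fun p => phaseAverage (p.1 0) (chartSphere p.1) := by
  have h1 := measurePreserving_parEquiv.quasiMeasurePreserving.ae
    (ae_first_entry_ne_zero (N := n + 1))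
  have h2 : (volume : Measure (Par n)) (chart '' {p | (fderiv ℝ chart p).det = 0}) = 0 :=
    addHaar_image_eq_zero_of_det_fderivWithin_eq_zero volume
      (fun p _ => (differentiable_chart p).hasFDerivAt.hasFDerivWithinAt) fun p hp => hp
  simp_rw [parEquiv_apply] at h1
  filter_upwards [h1, measure_eq_zero_iff_ae_notMem.1 h2] with y hy1 hy2
  exact empiricalMeasure_toMat hy1 hy2

theorem map_withDensity_comp {α β : Type*} [MeasurableSpace α] [MeasurableSpace β]
    {μ : Measure α} {ν : Measure β} {T : α → β} (hT : MeasurePreserving T μ ν)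
    {g : β → ENNReal} (hg : Measurable g) :
    (μ.withDensity fun x => g (T x)).map T = ν.withDensity g := by
  ext s hs
  rw [Measure.map_apply hT.measurable hs, withDensity_apply _ (hT.measurable hs),
    withDensity_apply _ hs, hT.setLIntegral_comp_preimage hs hg]

theorem meanEmpiricalMeasure_apply {g : (Fin (n + 1) → Fin (n + 1) → ℂ) → ENNReal}
    (hg : Measurable g) (hG : ginibre (n + 1) = volume.withDensity g)
    (A : Matrix (Fin (n + 1)) (Fin (n + 1)) ℂ) {s : Set (ℂ × CSphere (n + 1))}
    (hs : MeasurableSet s) :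
    meanEmpiricalMeasure A s = ∫⁻ p : Par n,
      g (toMat (chart p) - A) * ENNReal.ofReal |(fderiv ℝ chart p).det| *
        phaseAverage (p.1 0) (chartSphere p.1) s := by
  let A' : Fin (n + 1) → Fin (n + 1) → ℂ := A
  let T : Par n ≃ᵐ (Fin (n + 1) → Fin (n + 1) → ℂ) :=
    (parEquiv n).trans (MeasurableEquiv.addRight (-A'))
  have hT : MeasurePreserving T volume volume :=
    (measurePreserving_add_right volume (-A')).comp measurePreserving_parEquiv
  have hTA : ∀ y, T y = toMat y - A := fun y => by
    rw [sub_eq_add_neg, ← parEquiv_apply]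
    rfl
  have hd := fun p => (differentiable_chart (n := n) p).hasFDerivAt
  have hc := continuous_fderiv_chart (n := n)
  have hF := measurable_regularFiber hd hc
  have hP := measurable_phaseAverage_chartSphere (n := n)
  let K : Par n → Measure (ℂ × CSphere (n + 1)) := fun y =>
    (regularFiber chart (fderiv ℝ chart) y).bind
      fun p => phaseAverage (p.1 0) (chartSphere p.1)
  have hK : Measurable K := (Measure.measurable_bind' hP).comp hF
  -- The empirical measure involves a choice of eigenvectors. It is replaced by the kernel `K`,
  -- which is measurable and agrees with it almost everywhere.
  have hae : (fun G : Fin (n + 1) → Fin (n + 1) → ℂ => empiricalMeasure (Matrix.of G + A))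
      =ᵐ[ginibre (n + 1)] fun G => K (T.symm G) := by
    rw [hG]
    refine (withDensity_absolutelyContinuous _ _).ae_le ?_
    filter_upwards [(hT.symm T).quasiMeasurePreserving.ae (ae_empiricalMeasure_toMat (n := n))]
      with G hGy
    have hGA : Matrix.of G + A = toMat (T.symm G) := by
      have := hTA (T.symm G)
      rw [T.apply_symm_apply] at this
      exact eq_sub_iff_add_eq.1 this
    rw [hGA]
    exact hGy
  have hgT : Measurable fun y => g (T y) := hg.comp T.measurable
  rw [meanEmpiricalMeasure, Measure.bind_congr_right hae, hG, ← map_withDensity_comp hT hg]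
  have h1 : ((volume.withDensity fun y => g (T y)).map T).bind (fun G => K (T.symm G)) =
      (volume.withDensity fun y => g (T y)).bind K := by
    have hKT : Measurable fun G => K (T.symm G) := hK.comp T.symm.measurable
    have hcomp : (fun G => K (T.symm G)) ∘ T = K := funext fun y => by simp
    rw [Measure.bind, Measure.map_map hKT T.measurable, Measure.bind, hcomp]
  rw [h1]
  change (Measure.bind _ fun y => (regularFiber chart (fderiv ℝ chart) y).bind _) s = _
  -- Associativity of `bind` applies the fibre kernel to the Gaussian density first, where the area
  -- formula evaluates it.
  rw [← Measure.bind_bind hF.aemeasurable hP.aemeasurable,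
    withDensity_bind_regularFiber volume hd hc hgT, Measure.bind_apply hs hP.aemeasurable,
    lintegral_withDensity_eq_lintegral_mul]
  · simp only [Pi.mul_apply, hTA]
  · exact (hgT.comp differentiable_chart.continuous.measurable).mul
      (ContinuousLinearMap.continuous_det.comp hc).abs.measurable.ennreal_ofReal
  · exact (Measure.measurable_coe hs).comp hP

end DeformedGinibre

namespace DeformedGinibre

/-! ### Permanents of the all-ones matrix plus a multiple of the identity -/

section PermSum

open Equiv

/-- The permanent of the `k × k` matrix with diagonal entries `1 + x` and other entries `1`. -/
def permSum (x : ℝ) (k : ℕ) : ℝ :=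
  ∑ σ : Perm (Fin k), ∏ i, (1 + if σ i = i then x else 0)

@[simp] theorem permSum_zero (x : ℝ) : permSum x 0 = 1 := by simp [permSum]

/-- Expansion of a permanent along row `0`. If `σ 0 = j.succ`, then `σ` is the transposition of `0`
and `j.succ` after a permutation `e` of the remaining indices. The index `j.succ` is then never
fixed, and the other fixed points are those of `e`. -/
theorem sum_perm_succ (x : ℝ) {m : ℕ} (F : Fin (m + 1) → ℝ) :
    ∑ σ : Perm (Fin (m + 1)), F (σ 0) * ∏ i : Fin m, (1 + if σ i.succ = i.succ then x else 0) =
      F 0 * permSum x m + ∑ j : Fin m, F j.succ *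
        ∑ e : Perm (Fin m), ∏ i ∈ Finset.univ.erase j, (1 + if e i = i then x else 0) := by
  rw [← Equiv.sum_comp (Perm.decomposeFin (n := m)).symm, Fintype.sum_prod_type,
    Fin.sum_univ_succ]
  congr 1
  · rw [permSum, Finset.mul_sum]
    refine Finset.sum_congr rfl fun e _ => ?_
    simp [Perm.decomposeFin_symm_apply_succ]
  · refine Finset.sum_congr rfl fun j _ => ?_
    rw [Finset.mul_sum]
    refine Finset.sum_congr rfl fun e _ => ?_
    rw [Perm.decomposeFin_symm_apply_zero, ← Finset.mul_prod_erase _ _ (Finset.mem_univ j)]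
    have h1 : (Perm.decomposeFin.symm (j.succ, e)) j.succ ≠ j.succ := by
      rw [Perm.decomposeFin_symm_apply_succ]
      intro h
      rw [swap_apply_eq_iff, swap_apply_right] at h
      exact Fin.succ_ne_zero _ h
    rw [if_neg h1, add_zero, one_mul]
    congr 1
    refine Finset.prod_congr rfl fun i hi => ?_
    have hij : i ≠ j := Finset.ne_of_mem_erase hi
    congr 1
    refine if_congr ?_ rfl rfl
    rw [Perm.decomposeFin_symm_apply_succ, swap_apply_eq_iff,
      swap_apply_of_ne_of_ne (Fin.succ_ne_zero _) (fun h => hij (Fin.succ_injective _ h)),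
      Fin.succ_inj]

/-- Conjugation by the transposition of `0` and `j` moves the fixed point to `0`, where the row
expansion with an indicator as `F` applies. -/
theorem sum_perm_fixing (x : ℝ) {m : ℕ} (j : Fin (m + 1)) :
    ∑ e : Perm (Fin (m + 1)), (if e j = j then 1 else 0) *
      ∏ i ∈ Finset.univ.erase j, (1 + if e i = i then x else 0) = permSum x m := by
  have h := sum_perm_succ x (m := m) (fun i => if i = 0 then 1 else 0)
  simp only [Fin.succ_ne_zero, if_true, if_false, zero_mul, Finset.sum_const_zero, one_mul,
    add_zero] at h
  rw [← h, ← Equiv.sum_comp (MulAut.conj (swap 0 j)).toEquiv]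
  refine Finset.sum_congr rfl fun e _ => ?_
  have hfix : ∀ i, (MulAut.conj (swap 0 j) e) i = i ↔ e (swap 0 j i) = swap 0 j i := by
    intro i
    rw [MulAut.conj_apply, Perm.mul_apply, Perm.mul_apply, swap_inv, swap_apply_eq_iff]
  simp only [MulEquiv.toEquiv_eq_coe, EquivLike.coe_coe, hfix, swap_apply_right]
  congr 1
  have h2 : ∏ i : Fin m, (1 + if e i.succ = i.succ then x else 0) =
      ∏ i ∈ Finset.univ.erase (0 : Fin (m + 1)), (1 + if e i = i then x else 0) := by
    rw [Fin.univ_succ, Finset.erase_cons, Finset.prod_map]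
    rfl
  rw [h2]
  refine Finset.prod_bij' (fun i _ => swap 0 j i) (fun i _ => swap 0 j i) ?_ ?_ ?_ ?_ ?_
  · intro i hi
    simpa [swap_apply_eq_iff] using hi
  · intro i hi
    simpa [swap_apply_eq_iff] using hi
  · simp
  · simp
  · simp

theorem sum_perm_erase (x : ℝ) {m : ℕ} (j : Fin (m + 1)) :
    ∑ e : Perm (Fin (m + 1)), ∏ i ∈ Finset.univ.erase j, (1 + if e i = i then x else 0) =
      permSum x (m + 1) - x * permSum x m := by
  rw [eq_sub_iff_add_eq, ← sum_perm_fixing x j, Finset.mul_sum, ← Finset.sum_add_distrib, permSum]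
  refine Finset.sum_congr rfl fun e _ => ?_
  rw [← Finset.mul_prod_erase _ _ (Finset.mem_univ j)]
  split_ifs <;> ring

theorem sum_perm_row (x : ℝ) {m : ℕ} (F : Fin (m + 1) → ℝ) :
    ∑ σ : Perm (Fin (m + 1)), F (σ 0) * ∏ i : Fin m, (1 + if σ i.succ = i.succ then x else 0) =
      F 0 * permSum x m + (∑ j : Fin m, F j.succ) * (permSum x m - x * permSum x (m - 1)) := by
  rw [sum_perm_succ, Finset.sum_mul]
  congr 1
  cases m with
  -- The sum over `j` is empty here, so the truncated `m - 1` is harmless.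
  | zero => simp
  | succ k => exact Finset.sum_congr rfl fun j _ => by rw [sum_perm_erase, Nat.add_sub_cancel]

theorem permSum_succ' (x : ℝ) (m : ℕ) :
    permSum x (m + 1) = (1 + x) * permSum x m + m * (permSum x m - x * permSum x (m - 1)) := by
  have h := sum_perm_row x (m := m) (fun i => 1 + if i = 0 then x else 0)
  simp only [Fin.succ_ne_zero, if_true, if_false, add_zero, Finset.sum_const, Finset.card_univ,
    Fintype.card_fin, nsmul_eq_mul, mul_one] at h
  rw [← h, permSum]
  exact Finset.sum_congr rfl fun σ _ => by rw [Fin.prod_univ_succ]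

/-- This is the recursion satisfied by `e^x Γ(m+1, x)`, obtained from the row expansion by
induction. -/
theorem permSum_succ (x : ℝ) (m : ℕ) :
    permSum x (m + 1) = (m + 1) * permSum x m + x ^ (m + 1) := by
  induction m with
  | zero => rw [permSum_succ']; simp
  | succ k ih =>
    rw [permSum_succ', Nat.add_sub_cancel, ih]
    push_cast
    ring

end PermSum

/-! ### Incomplete Gamma functions at integers -/

section UpperGamma

open Real Set Filter

theorem integrableOn_pow_mul_exp_neg {x : ℝ} (hx : 0 ≤ x) (k : ℕ) :
    IntegrableOn (fun t : ℝ => t ^ k * exp (-t)) (Ioi x) := by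
  have h := (Real.GammaIntegral_convergent (s := (k : ℝ) + 1) (by positivity)).mono_set
    (Ioi_subset_Ioi hx)
  refine h.congr_fun (fun t _ => ?_) measurableSet_Ioi
  simp only [add_sub_cancel_right, rpow_natCast]
  ring

theorem upperGamma_natCast_succ (k : ℕ) (x : ℝ) :
    upperGamma ((k : ℝ) + 1) x = ∫ t in Ioi x, t ^ k * exp (-t) := by
  simp only [upperGamma, add_sub_cancel_right, rpow_natCast]

theorem upperGamma_one (x : ℝ) : upperGamma 1 x = exp (-x) := by
  have h := upperGamma_natCast_succ 0 x
  simp only [Nat.cast_zero, zero_add, pow_zero, one_mul] at h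
  rw [h, integral_exp_neg_Ioi]

theorem upperGamma_add_one {x : ℝ} (hx : 0 ≤ x) (k : ℕ) :
    upperGamma ((k : ℝ) + 1 + 1) x = (k + 1) * upperGamma ((k : ℝ) + 1) x
      + x ^ (k + 1) * exp (-x) := by
  have h1 := upperGamma_natCast_succ (k + 1) x
  push_cast at h1
  rw [h1, upperGamma_natCast_succ]
  have hd : ∀ t ∈ Ici x, HasDerivAt (fun t : ℝ => -(t ^ (k + 1) * exp (-t)))
      (t ^ (k + 1) * exp (-t) - (k + 1) * (t ^ k * exp (-t))) t := by
    intro t _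
    have h := ((hasDerivAt_pow (k + 1) t).mul (hasDerivAt_neg t).exp).neg
    refine h.congr_deriv ?_
    push_cast
    ring
  have hi1 := integrableOn_pow_mul_exp_neg hx (k + 1)
  have hi2 := (integrableOn_pow_mul_exp_neg hx k).const_mul ((k : ℝ) + 1)
  have ht : Tendsto (fun t : ℝ => -(t ^ (k + 1) * exp (-t))) atTop (nhds 0) := by
    simpa using (tendsto_pow_mul_exp_neg_atTop_nhds_zero (k + 1)).neg
  have h := integral_Ioi_of_hasDerivAt_of_tendsto' hd (hi1.sub hi2) ht
  rw [integral_sub hi1 hi2, integral_const_mul] at h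
  linarith

theorem permSum_eq_upperGamma {x : ℝ} (hx : 0 ≤ x) (k : ℕ) :
    permSum x k = exp x * upperGamma ((k : ℝ) + 1) x := by
  induction k with
  | zero => simp [upperGamma_one, ← exp_add]
  | succ k ih =>
    rw [permSum_succ, ih]
    push_cast
    rw [upperGamma_add_one hx]
    have : exp x * exp (-x) = 1 := by simp [← exp_add]
    linear_combination -x ^ (k + 1) * this

end UpperGamma

end DeformedGinibre

namespace DeformedGinibre

/-! ### Densities of product measures -/

section PiDensity

variable {α : Type*} [MeasurableSpace α]

theorem lintegral_pi_prod (μ : Measure α) [SigmaFinite μ] {k : ℕ} {f : Fin k → α → ENNReal}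
    (hf : ∀ i, Measurable (f i)) :
    ∫⁻ x, ∏ i, f i (x i) ∂(Measure.pi fun _ : Fin k => μ) = ∏ i, ∫⁻ t, f i t ∂μ := by
  induction k with
  | zero => simp
  | succ k ih =>
    have hm := (measurePreserving_piFinSuccAbove (fun _ : Fin (k + 1) => μ) 0).symm _
    rw [← hm.lintegral_comp_emb (MeasurableEquiv.measurableEmbedding _), Fin.prod_univ_succ,
      ← ih fun i => hf i.succ, ← lintegral_prod_mul (hf 0).aemeasurable]
    · refine lintegral_congr fun p => ?_
      rw [Fin.prod_univ_succ]
      congr 1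
    · exact (Finset.measurable_prod _ fun i _ =>
        (hf _).comp (measurable_pi_apply i)).aemeasurable

theorem pi_withDensity (μ : Measure α) [SigmaFinite μ] {f : α → ENNReal} (hf : Measurable f)
    [SigmaFinite (μ.withDensity f)] (k : ℕ) :
    Measure.pi (fun _ : Fin k => μ.withDensity f) =
      (Measure.pi fun _ : Fin k => μ).withDensity fun x => ∏ i, f (x i) := by
  refine Measure.pi_eq (μ := fun _ : Fin k => μ.withDensity f) fun s hs => ?_
  have hS : MeasurableSet (Set.univ.pi s) := MeasurableSet.univ_pi hs
  rw [withDensity_apply _ hS, ← lintegral_indicator hS]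
  have h1 : ∀ x : Fin k → α, (Set.univ.pi s).indicator (fun x => ∏ i, f (x i)) x =
      ∏ i, (s i).indicator f (x i) := by
    intro x
    by_cases hx : x ∈ Set.univ.pi s
    · rw [Set.indicator_of_mem hx]
      exact Finset.prod_congr rfl fun i _ => (Set.indicator_of_mem (hx i trivial) _).symm
    · rw [Set.indicator_of_notMem hx]
      simp only [Set.mem_univ_pi, not_forall] at hx
      obtain ⟨i, hi⟩ := hx
      exact (Finset.prod_eq_zero (Finset.mem_univ i) (Set.indicator_of_notMem hi _)).symm
  simp_rw [h1]
  rw [lintegral_pi_prod μ fun i => hf.indicator (hs i)]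
  exact Finset.prod_congr rfl fun i _ => by
    rw [lintegral_indicator (hs i), withDensity_apply _ (hs i)]

end PiDensity

/-! ### Density and moments of the complex normal law -/

section ComplexNormal

theorem measurable_complexNormal_map : Measurable fun p : ℝ × ℝ =>
    ((p.1 : ℂ) + Complex.I * (p.2 : ℂ)) / ((Real.sqrt 2 : ℝ) : ℂ) := by
  fun_prop

instance isProbabilityMeasure_complexNormal : IsProbabilityMeasure complexNormal :=
  Measure.isProbabilityMeasure_map measurable_complexNormal_map.aemeasurable

instance isProbabilityMeasure_ginibre (N : ℕ) : IsProbabilityMeasure (ginibre N) :=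
  inferInstanceAs (IsProbabilityMeasure (Measure.pi fun _ => Measure.pi fun _ => complexNormal))

/-- The density of the standard complex normal law. -/
def gaussDensity (z : ℂ) : ENNReal := ENNReal.ofReal (Real.pi⁻¹ * Real.exp (-‖z‖ ^ 2))

theorem measurable_gaussDensity : Measurable gaussDensity := by
  unfold gaussDensity
  fun_prop

theorem complexNormal_eq_withDensity : complexNormal = volume.withDensity gaussDensity := by
  have hpi := Real.pi_pos
  have h2 : Real.sqrt 2 ≠ 0 := by positivity
  set c : ℝ := (Real.sqrt 2)⁻¹ with hc
  have hc2 : c ^ 2 = 1 / 2 := by rw [hc, inv_pow, Real.sq_sqrt (by norm_num)]; norm_num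
  let g3 : ℂ → ENNReal := fun z => ENNReal.ofReal ((2 * Real.pi)⁻¹ * Real.exp (-‖z‖ ^ 2))
  have hg3 : Measurable g3 := by fun_prop
  have hgc : Measurable fun w : ℂ => g3 (c • w) := hg3.comp (measurable_const_smul c)
  -- Scaling the plane by `c` multiplies Lebesgue measure by `c⁻² = 2`.
  have hs : MeasurePreserving (fun w : ℂ => c • w) volume ((2 : ENNReal) • volume) := by
    refine ⟨measurable_const_smul c, ?_⟩
    rw [Measure.map_addHaar_smul _ (inv_ne_zero h2), Complex.finrank_real_complex, hc2]
    norm_num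
  have hdens : (gaussianReal 0 1).prod (gaussianReal 0 1) =
      (volume : Measure (ℝ × ℝ)).withDensity
        fun p => g3 (c • Complex.measurableEquivRealProd.symm p) := by
    rw [gaussianReal_of_var_ne_zero 0 one_ne_zero,
      prod_withDensity (measurable_gaussianPDF 0 1) (measurable_gaussianPDF 0 1)]
    congr 1
    ext1 p
    rw [gaussianPDF, gaussianPDF, ← ENNReal.ofReal_mul (gaussianPDFReal_nonneg _ _ _)]
    simp only [g3]
    congr 1
    have hn : ‖c • Complex.measurableEquivRealProd.symm p‖ ^ 2 = (p.1 ^ 2 + p.2 ^ 2) / 2 := by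
      rw [norm_smul, mul_pow, Real.norm_eq_abs, sq_abs, hc2, ← Complex.normSq_eq_norm_sq,
        Complex.normSq_apply]
      simp
      ring
    rw [hn, gaussianPDFReal, gaussianPDFReal]
    have hq : (Real.sqrt (2 * Real.pi * ((1 : NNReal) : ℝ)))⁻¹ *
        (Real.sqrt (2 * Real.pi * ((1 : NNReal) : ℝ)))⁻¹ = (2 * Real.pi)⁻¹ := by
      rw [← mul_inv, Real.mul_self_sqrt (by positivity)]
      simp
    rw [mul_mul_mul_comm, hq, ← Real.exp_add]
    congr 2
    simp
    ring
  have hfun : (fun p : ℝ × ℝ => ((p.1 : ℂ) + Complex.I * (p.2 : ℂ)) / ((Real.sqrt 2 : ℝ) : ℂ)) =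
      (fun w : ℂ => c • w) ∘ Complex.measurableEquivRealProd.symm := by
    ext1 p
    simp only [Function.comp_apply, Complex.measurableEquivRealProd_symm_apply,
      Complex.real_smul, hc, Complex.ofReal_inv, Complex.mk_eq_add_mul_I]
    ring
  rw [complexNormal, hfun, ← Measure.map_map (measurable_const_smul c)
    Complex.measurableEquivRealProd.symm.measurable, hdens,
    map_withDensity_comp (Complex.volume_preserving_equiv_real_prod.symm _) hgc,
    map_withDensity_comp hs hg3, withDensity_smul_measure, ← withDensity_smul _ hg3]
  congr 1
  ext1 z
  simp only [Pi.smul_apply, smul_eq_mul, g3, gaussDensity]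
  rw [show (2 : ENNReal) = ENNReal.ofReal 2 by simp, ← ENNReal.ofReal_mul (by norm_num)]
  congr 1
  field_simp

instance sigmaFinite_withDensity_gaussDensity : SigmaFinite (volume.withDensity gaussDensity) :=
  complexNormal_eq_withDensity ▸ inferInstance

theorem pi_complexNormal (k : ℕ) : Measure.pi (fun _ : Fin k => complexNormal) =
    volume.withDensity fun x => ∏ i, gaussDensity (x i) := by
  rw [complexNormal_eq_withDensity, pi_withDensity _ measurable_gaussDensity]
  rfl

theorem pi_pi_complexNormal (k m : ℕ) :
    Measure.pi (fun _ : Fin k => Measure.pi fun _ : Fin m => complexNormal) =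
      volume.withDensity fun x => ∏ i, ∏ j, gaussDensity (x i j) := by
  have h : SigmaFinite ((volume : Measure (Fin m → ℂ)).withDensity
      fun x => ∏ i, gaussDensity (x i)) := pi_complexNormal m ▸ inferInstance
  have hm : Measurable fun x : Fin m → ℂ => ∏ i, gaussDensity (x i) :=
    Finset.measurable_prod _ fun i _ => measurable_gaussDensity.comp (measurable_pi_apply i)
  rw [pi_complexNormal, pi_withDensity _ hm]
  rfl

theorem integrable_gaussianReal_id : Integrable (fun x : ℝ => x) (gaussianReal 0 1) :=
  (memLp_id_gaussianReal 1).integrable le_rfl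

theorem integrable_gaussianReal_sq : Integrable (fun x : ℝ => x ^ 2) (gaussianReal 0 1) :=
  (memLp_id_gaussianReal 2).integrable_sq

theorem integral_gaussianReal_sq : ∫ x, x ^ 2 ∂(gaussianReal 0 1) = 1 := by
  have h := variance_id_gaussianReal (μ := 0) (v := 1)
  rw [variance_of_integral_eq_zero aemeasurable_id (by simp)] at h
  simpa using h

theorem integrable_complexNormal_id : Integrable (fun z : ℂ => z) complexNormal := by
  rw [complexNormal, integrable_map_measure (by fun_prop) (by fun_prop)]
  have h := integrable_gaussianReal_id.ofReal (𝕜 := ℂ)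
  exact ((h.comp_fst _).add ((h.comp_snd _).const_mul _)).div_const _

theorem integral_complexNormal_id : ∫ z, z ∂complexNormal = 0 := by
  rw [complexNormal, integral_map (by fun_prop) (by fun_prop)]
  have h := integrable_gaussianReal_id.ofReal (𝕜 := ℂ)
  have h1 : Integrable (fun p : ℝ × ℝ => (p.1 : ℂ)) ((gaussianReal 0 1).prod (gaussianReal 0 1)) :=
    h.comp_fst _
  have h2 : Integrable (fun p : ℝ × ℝ => Complex.I * (p.2 : ℂ))
      ((gaussianReal 0 1).prod (gaussianReal 0 1)) := (h.comp_snd _).const_mul _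
  rw [integral_div, integral_add h1 h2,
    integral_const_mul, integral_fun_fst (fun x : ℝ => (x : ℂ)),
    integral_fun_snd (fun x : ℝ => (x : ℂ)), integral_complex_ofReal]
  simp

theorem norm_sq_complexNormal_map (p : ℝ × ℝ) :
    ‖((p.1 : ℂ) + Complex.I * (p.2 : ℂ)) / ((Real.sqrt 2 : ℝ) : ℂ)‖ ^ 2 =
      (p.1 ^ 2 + p.2 ^ 2) / 2 := by
  rw [norm_div, div_pow, Complex.norm_real, Real.norm_eq_abs, sq_abs,
    Real.sq_sqrt (by norm_num), ← Complex.normSq_eq_norm_sq, mul_comm, Complex.normSq_add_mul_I]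

theorem integrable_complexNormal_norm_sq : Integrable (fun z : ℂ => ‖z‖ ^ 2) complexNormal := by
  rw [complexNormal, integrable_map_measure (by fun_prop) (by fun_prop)]
  simp only [Function.comp_def, norm_sq_complexNormal_map]
  exact ((integrable_gaussianReal_sq.comp_fst _).add
    (integrable_gaussianReal_sq.comp_snd _)).div_const _

theorem integral_complexNormal_norm_sq : ∫ z, ‖z‖ ^ 2 ∂complexNormal = 1 := by
  rw [complexNormal, integral_map (by fun_prop) (by fun_prop)]
  simp only [norm_sq_complexNormal_map]
  rw [integral_div, integral_add (integrable_gaussianReal_sq.comp_fst _)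
    (integrable_gaussianReal_sq.comp_snd _), integral_fun_fst (fun x : ℝ => x ^ 2),
    integral_fun_snd (fun x : ℝ => x ^ 2), integral_gaussianReal_sq]
  simp

theorem integrable_add_complexNormal (y : ℂ) : Integrable (fun t => y + t) complexNormal :=
  (integrable_const y).add integrable_complexNormal_id

theorem integral_add_complexNormal (y : ℂ) : ∫ t, (y + t) ∂complexNormal = y := by
  rw [integral_add (integrable_const y) integrable_complexNormal_id, integral_complexNormal_id]
  simp

theorem integrable_conj_add_complexNormal (y : ℂ) :
    Integrable (fun t => conj (y + t)) complexNormal :=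
  Complex.conjCLE.toContinuousLinearMap.integrable_comp (integrable_add_complexNormal y)

theorem integral_conj_add_complexNormal (y : ℂ) :
    ∫ t, conj (y + t) ∂complexNormal = conj y := by
  rw [integral_conj, integral_add_complexNormal]

theorem integrable_mul_conj_complexNormal :
    Integrable (fun t : ℂ => t * conj t) complexNormal := by
  simp_rw [Complex.mul_conj, Complex.normSq_eq_norm_sq]
  exact integrable_complexNormal_norm_sq.ofReal

theorem add_mul_conj_add (y t : ℂ) :
    (y + t) * conj (y + t) = (conj y * (y + t) + y * conj (0 + t)) + t * conj t := by
  simp only [map_add, map_zero]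
  ring

theorem integrable_mul_conj_add_complexNormal (y : ℂ) :
    Integrable (fun t => (y + t) * conj (y + t)) complexNormal := by
  simp_rw [add_mul_conj_add]
  exact (((integrable_add_complexNormal y).const_mul _).add
    ((integrable_conj_add_complexNormal 0).const_mul _)).add integrable_mul_conj_complexNormal

theorem integral_mul_conj_add_complexNormal (y : ℂ) :
    ∫ t, (y + t) * conj (y + t) ∂complexNormal = y * conj y + 1 := by
  simp_rw [add_mul_conj_add]
  have h1 : Integrable (fun t => conj y * (y + t)) complexNormal :=
    (integrable_add_complexNormal y).const_mul _
  have h2 : Integrable (fun t => y * conj (0 + t)) complexNormal :=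
    (integrable_conj_add_complexNormal 0).const_mul _
  have h12 : Integrable (fun t => conj y * (y + t) + y * conj (0 + t)) complexNormal := h1.add h2
  rw [integral_add h12 integrable_mul_conj_complexNormal, integral_add h1 h2, integral_const_mul, integral_const_mul,
    integral_add_complexNormal, integral_conj_add_complexNormal]
  simp_rw [Complex.mul_conj, Complex.normSq_eq_norm_sq]
  rw [integral_complex_ofReal, integral_complexNormal_norm_sq]
  simp [mul_comm, ← Complex.mul_conj']

end ComplexNormal

/-! ### Second moments of Gaussian determinants -/

section GaussianDet

variable {k : ℕ}

/-- The factor at the coordinate `i` of `(y a + g a) * conj (y b + g b)`. -/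
def rowFactor (y : Fin k → ℂ) (a b i : Fin k) (t : ℂ) : ℂ :=
  (if i = a then y i + t else 1) * (if i = b then conj (y i + t) else 1)

/-- As a product over all coordinates the integrand factors under the product measure, with `a = b`
and `a ≠ b` treated alike. -/
theorem prod_rowFactor (y : Fin k → ℂ) (a b : Fin k) (g : Fin k → ℂ) :
    ∏ i, rowFactor y a b i (g i) = (y a + g a) * conj (y b + g b) := by
  simp only [rowFactor, Finset.prod_mul_distrib, Finset.prod_ite_eq', Finset.mem_univ, if_true]

theorem integrable_rowFactor (y : Fin k → ℂ) (a b i : Fin k) :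
    Integrable (rowFactor y a b i) complexNormal := by
  unfold rowFactor
  by_cases ha : i = a <;> by_cases hb : i = b <;> simp only [ha, hb, if_true, if_false, mul_one]
  · subst ha; subst hb
    simpa using integrable_mul_conj_add_complexNormal _
  · subst ha
    simpa [hb] using integrable_add_complexNormal _
  · subst hb
    simpa [ha] using integrable_conj_add_complexNormal (y i)
  · exact integrable_const _

theorem integral_rowFactor (y : Fin k → ℂ) (a b i : Fin k) :
    ∫ t, rowFactor y a b i t ∂complexNormal =
      (if i = a then y i else 1) * (if i = b then conj (y i) else 1) +
        if i = a ∧ i = b then 1 else 0 := by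
  unfold rowFactor
  by_cases ha : i = a <;> by_cases hb : i = b <;> simp only [ha, hb, if_true, if_false, mul_one,
    and_self, and_true, add_zero]
  · subst ha; subst hb
    simpa using integral_mul_conj_add_complexNormal _
  · subst ha
    simpa [hb] using integral_add_complexNormal _
  · subst hb
    simpa [ha] using integral_conj_add_complexNormal _
  · simp

theorem integrable_row (y : Fin k → ℂ) (a b : Fin k) :
    Integrable (fun g => (y a + g a) * conj (y b + g b))
      (Measure.pi fun _ : Fin k => complexNormal) := by
  simp_rw [← prod_rowFactor]
  exact Integrable.fintype_prod fun i => integrable_rowFactor y a b i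

theorem integral_row (y : Fin k → ℂ) (a b : Fin k) :
    ∫ g, (y a + g a) * conj (y b + g b) ∂(Measure.pi fun _ : Fin k => complexNormal) =
      y a * conj (y b) + if a = b then 1 else 0 := by
  simp_rw [← prod_rowFactor]
  rw [integral_fintype_prod_eq_prod]
  simp_rw [integral_rowFactor]
  by_cases hab : a = b
  · subst hab
    rw [Finset.prod_eq_single a]
    · simp
    · intro i _ hi
      simp [hi]
    · simp
  · have h : ∀ i, ¬(i = a ∧ i = b) := fun i hi => hab (hi.1.symm.trans hi.2)
    simp only [h, hab, if_false, add_zero, Finset.prod_mul_distrib, Finset.prod_ite_eq',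
      Finset.mem_univ, if_true]

theorem norm_sq_det_eq_sum (M : Matrix (Fin k) (Fin k) ℂ) :
    ((‖M.det‖ ^ 2 : ℝ) : ℂ) = ∑ σ : Equiv.Perm (Fin k), ∑ τ : Equiv.Perm (Fin k),
      (((Equiv.Perm.sign σ : ℤ) : ℂ) * ((Equiv.Perm.sign τ : ℤ) : ℂ)) *
        ∏ i, (M i (σ i) * conj (M i (τ i))) := by
  rw [← Complex.normSq_eq_norm_sq, ← Complex.mul_conj, ← Matrix.det_transpose, Matrix.det_apply',
    map_sum, Finset.sum_mul_sum]
  refine Finset.sum_congr rfl fun σ _ => Finset.sum_congr rfl fun τ _ => ?_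
  rw [map_mul, map_prod, Finset.prod_mul_distrib]
  simp only [Matrix.transpose_apply, map_intCast]
  ring

/-- A permutation fixing every point but one fixes that one too. Hence distinct permutations differ
in some row other than the exceptional one, which kills the cross terms of the second moment. -/
theorem perm_eq_of_eq_off {ι : Type*} {σ τ : Equiv.Perm ι} {i₀ : ι}
    (h : ∀ i ≠ i₀, σ i = τ i) : σ = τ := by
  classical
  have h1 : ∀ i ≠ i₀, (τ⁻¹ * σ) i = i := fun i hi => by simp [h i hi]
  have h2 : (τ⁻¹ * σ) i₀ = i₀ := by
    by_contra hne
    exact hne ((τ⁻¹ * σ).injective (h1 _ hne))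
  ext i
  by_cases hi : i = i₀
  · subst hi
    have := congrArg τ h2
    simpa using this
  · exact h i hi

variable {C : Fin k → Fin k → ℂ}

theorem integrable_prod_row (σ τ : Equiv.Perm (Fin k)) :
    Integrable (fun G : Fin k → Fin k → ℂ =>
      ∏ i, ((C i (σ i) + G i (σ i)) * conj (C i (τ i) + G i (τ i)))) (ginibre k) :=
  Integrable.fintype_prod (f := fun i (g : Fin k → ℂ) =>
    (C i (σ i) + g (σ i)) * conj (C i (τ i) + g (τ i))) fun _ => integrable_row _ _ _

theorem integral_prod_row (σ τ : Equiv.Perm (Fin k)) :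
    ∫ G : Fin k → Fin k → ℂ,
      ∏ i, ((C i (σ i) + G i (σ i)) * conj (C i (τ i) + G i (τ i))) ∂(ginibre k) =
      ∏ i, (C i (σ i) * conj (C i (τ i)) + if σ i = τ i then 1 else 0) := by
  rw [ginibre, integral_fintype_prod_eq_prod (f := fun i (g : Fin k → ℂ) =>
    (C i (σ i) + g (σ i)) * conj (C i (τ i) + g (τ i)))]
  exact Finset.prod_congr rfl fun i _ => integral_row _ _ _

theorem integrable_norm_sq_det :
    Integrable (fun G : Fin k → Fin k → ℂ => ‖(Matrix.of fun i j => C i j + G i j).det‖ ^ 2)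
      (ginibre k) := by
  have h : Integrable (fun G : Fin k → Fin k → ℂ =>
      ((‖(Matrix.of fun i j => C i j + G i j).det‖ ^ 2 : ℝ) : ℂ)) (ginibre k) := by
    simp_rw [norm_sq_det_eq_sum, Matrix.of_apply]
    exact integrable_finsetSum _ fun σ _ => integrable_finsetSum _ fun τ _ =>
      (integrable_prod_row σ τ).const_mul _
  exact h.re

/-- The second moment of the determinant of a Gaussian matrix whose mean has at most one nonzero
entry in every row, with one exception. -/
theorem integral_norm_sq_det (i₀ : Fin k)
    (hC : ∀ i ≠ i₀, ∀ a b, a ≠ b → C i a * conj (C i b) = 0) :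
    ∫ G : Fin k → Fin k → ℂ, ‖(Matrix.of fun i j => C i j + G i j).det‖ ^ 2 ∂(ginibre k) =
      ∑ σ : Equiv.Perm (Fin k), ∏ i, (‖C i (σ i)‖ ^ 2 + 1) := by
  rw [← Complex.ofReal_inj, ← integral_complex_ofReal]
  simp_rw [norm_sq_det_eq_sum, Matrix.of_apply]
  rw [integral_finsetSum _ fun σ _ => integrable_finsetSum _ fun τ _ =>
    (integrable_prod_row σ τ).const_mul _, Complex.ofReal_sum]
  refine Finset.sum_congr rfl fun σ _ => ?_
  rw [integral_finsetSum _ fun τ _ => (integrable_prod_row σ τ).const_mul _,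
    Finset.sum_eq_single σ]
  · rw [integral_const_mul]
    rw [integral_prod_row]
    have hs : (((Equiv.Perm.sign σ : ℤ) : ℂ) * ((Equiv.Perm.sign σ : ℤ) : ℂ)) = 1 := by
      rw [← Int.cast_mul, Int.units_coe_mul_self, Int.cast_one]
    rw [hs, one_mul, Complex.ofReal_prod]
    refine Finset.prod_congr rfl fun i _ => ?_
    rw [if_pos rfl, Complex.mul_conj, Complex.normSq_eq_norm_sq]
    push_cast
    rfl
  · intro τ _ hτ
    rw [integral_const_mul]
    rw [integral_prod_row]
    have : ∃ i, i ≠ i₀ ∧ σ i ≠ τ i := by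
      by_contra! hall
      exact hτ (perm_eq_of_eq_off hall).symm
    obtain ⟨i, hi, hne⟩ := this
    rw [Finset.prod_eq_zero (Finset.mem_univ i), mul_zero]
    rw [hC i hi _ _ hne, if_neg hne, add_zero]
  · simp

end GaussianDet

end DeformedGinibre

namespace DeformedGinibre

variable {n : ℕ}

/-! ### Frames adapted to the eigenvector, and the density in frame coordinates -/

section Frame

/-- Gram–Schmidt on `v` and `r`. In such a frame the matrix `a r l*` has nonzero entries only in its
first two rows. -/
theorem exists_frame (v : CVec (n + 1)) (hv : ‖v‖ = 1) (r : CVec (n + 1)) :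
    ∃ b : OrthonormalBasis (Fin (n + 1)) ℂ (CVec (n + 1)), b 0 = v ∧
      ∀ i : Fin (n + 1), 2 ≤ i.val → inner ℂ (b i) r = 0 := by
  have hcard : Module.finrank ℂ (CVec (n + 1)) = Fintype.card (Fin (n + 1)) := by simp
  have hvv : inner ℂ v v = 1 := by rw [inner_self_eq_norm_sq_to_K, hv]; simp
  set w : CVec (n + 1) := r - inner ℂ v r • v with hw
  have hvw : inner ℂ v w = 0 := by
    rw [hw, inner_sub_right, inner_smul_right, hvv, mul_one, sub_self]
  have hr : r = inner ℂ v r • v + w := by rw [hw]; abel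
  -- In dimension one there is nothing to check; if `w = 0`, then `r` is a multiple of `v`. In both
  -- cases any completion of `v` works.
  by_cases h : n = 0 ∨ w = 0
  · have ho : Orthonormal ℂ (Set.domRestrict {0} (fun _ : Fin (n + 1) => v)) := by
      refine ⟨fun i => hv, fun i j hij => (hij ?_).elim⟩
      exact Subsingleton.elim _ _
    obtain ⟨b, hb⟩ := ho.exists_orthonormalBasis_extension_of_card_eq hcard
    have hb0 : b 0 = v := hb 0 rfl
    refine ⟨b, hb0, fun i hi => ?_⟩
    rcases h with h | h
    · omega
    · have hi0 : i ≠ 0 := fun h0 => by rw [h0] at hi; simp at hi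
      rw [hr, h, add_zero, ← hb0, inner_smul_right, b.orthonormal.2 hi0, mul_zero]
  · push Not at h
    obtain ⟨m, rfl⟩ := Nat.exists_eq_succ_of_ne_zero h.1
    have hw0 : ‖w‖ ≠ 0 := norm_ne_zero_iff.2 h.2
    let f : Fin (m + 2) → CVec (m + 2) := fun i => if i = 0 then v else (‖w‖⁻¹ : ℂ) • w
    have h10 : (1 : Fin (m + 2)) ≠ 0 := by simp
    have hf1 : f 1 = (‖w‖⁻¹ : ℂ) • w := if_neg h10
    have hn1 : ‖(‖w‖⁻¹ : ℂ) • w‖ = 1 := by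
      rw [norm_smul, norm_inv, Complex.norm_real, norm_norm, inv_mul_cancel₀ hw0]
    have ho : Orthonormal ℂ (Set.domRestrict {0, 1} f) := by
      refine ⟨?_, ?_⟩
      · rintro ⟨i, hi⟩
        rcases hi with rfl | rfl
        · exact hv
        · exact (congrArg norm hf1).trans hn1
      · rintro ⟨i, hi⟩ ⟨j, hj⟩ hij
        rcases hi with rfl | rfl <;> rcases hj with rfl | rfl
        · exact (hij rfl).elim
        · change inner ℂ (f 0) (f 1) = 0
          rw [hf1, inner_smul_right]
          exact mul_eq_zero_of_right _ hvw
        · change inner ℂ (f 1) (f 0) = 0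
          rw [hf1, inner_smul_left]
          exact mul_eq_zero_of_right _ (inner_eq_zero_symm.1 hvw)
        · exact (hij rfl).elim
    obtain ⟨b, hb⟩ := ho.exists_orthonormalBasis_extension_of_card_eq hcard
    have hb0 : b 0 = v := hb 0 (by simp)
    have hb1 : b 1 = (‖w‖⁻¹ : ℂ) • w := (hb 1 (by simp)).trans hf1
    have hwb : w = (‖w‖ : ℂ) • b 1 := by
      rw [hb1, smul_smul, mul_inv_cancel₀ (by exact_mod_cast hw0), one_smul]
    refine ⟨b, hb0, fun i hi => ?_⟩
    have hi0 : i ≠ 0 := fun h0 => by rw [h0] at hi; simp at hi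
    have hi1 : i ≠ 1 := fun h0 => by rw [h0] at hi; simp at hi
    rw [hr, hwb, ← hb0, inner_add_right, inner_smul_right, inner_smul_right,
      b.orthonormal.2 hi0, b.orthonormal.2 hi1, mul_zero, mul_zero, add_zero]

/-- The mean of the lower right block of `a r l* - z`, in the frame `b`. -/
def frameBlock (a z : ℂ) (r l : CVec (n + 1))
    (b : OrthonormalBasis (Fin (n + 1)) ℂ (CVec (n + 1))) : Fin n → Fin n → ℂ := fun i j =>
  a * inner ℂ (b i.succ) r * conj (inner ℂ (b j.succ) l) - if i = j then z else 0

/-- The squared norm of the first column of `z - a r l*`, in the frame `b`. -/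
def frameExponent (a z : ℂ) (r l : CVec (n + 1))
    (b : OrthonormalBasis (Fin (n + 1)) ℂ (CVec (n + 1))) : ℝ :=
  ‖z - a * inner ℂ (b 0) r * conj (inner ℂ (b 0) l)‖ ^ 2 +
    ∑ i : Fin n, ‖a * inner ℂ (b i.succ) r * conj (inner ℂ (b 0) l)‖ ^ 2

/-- The second moment of the determinant of the lower right block. -/
def frameMoment (a z : ℂ) (r l : CVec (n + 1))
    (b : OrthonormalBasis (Fin (n + 1)) ℂ (CVec (n + 1))) : ℝ :=
  ∑ σ : Equiv.Perm (Fin n), ∏ i, (‖frameBlock a z r l b i (σ i)‖ ^ 2 + 1)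

theorem frameMoment_nonneg (a z : ℂ) (r l : CVec (n + 1))
    (b : OrthonormalBasis (Fin (n + 1)) ℂ (CVec (n + 1))) : 0 ≤ frameMoment a z r l b :=
  Finset.sum_nonneg fun _ _ => Finset.prod_nonneg fun _ _ => by positivity

variable {a z : ℂ} {r l : CVec (n + 1)} {b : OrthonormalBasis (Fin (n + 1)) ℂ (CVec (n + 1))}

theorem norm_sq_sub_eq (w z : ℂ) : ‖w - z‖ ^ 2 = ‖w‖ ^ 2 + ‖z‖ ^ 2 - 2 * (conj z * w).re := by
  rw [← Complex.normSq_eq_norm_sq, ← Complex.normSq_eq_norm_sq, ← Complex.normSq_eq_norm_sq,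
    Complex.normSq_sub, mul_comm (conj z)]

/-- Below its row `0` the block is `-z` times the identity, since the frame vectors there are
orthogonal to `r`. Row `0` therefore plays the part of `F` in `sum_perm_row`. -/
theorem frameMoment_eq {m : ℕ} {r l : CVec (m + 1 + 1)}
    {b : OrthonormalBasis (Fin (m + 1 + 1)) ℂ (CVec (m + 1 + 1))}
    (hb : ∀ i : Fin (m + 1 + 1), 2 ≤ i.val → inner ℂ (b i) r = 0) :
    frameMoment a z r l b =
      (‖a * inner ℂ (b 1) r * conj (inner ℂ (b 1) l) - z‖ ^ 2 + 1) * permSum (‖z‖ ^ 2) m +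
        (‖a‖ ^ 2 * ‖inner ℂ (b 1) r‖ ^ 2 * ∑ j : Fin m, ‖inner ℂ (b j.succ.succ) l‖ ^ 2 + m) *
          (permSum (‖z‖ ^ 2) m - ‖z‖ ^ 2 * permSum (‖z‖ ^ 2) (m - 1)) := by
  have h := sum_perm_row (‖z‖ ^ 2) (m := m) (fun j => ‖frameBlock a z r l b 0 j‖ ^ 2 + 1)
  have h1 : ∀ j : Fin m, ‖frameBlock a z r l b 0 j.succ‖ ^ 2 + 1 =
      ‖a‖ ^ 2 * ‖inner ℂ (b 1) r‖ ^ 2 * ‖inner ℂ (b j.succ.succ) l‖ ^ 2 + 1 := fun j => by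
    rw [frameBlock, if_neg (Fin.succ_ne_zero j).symm, sub_zero, norm_mul, norm_mul,
      RCLike.norm_conj, mul_pow, mul_pow, Fin.succ_zero_eq_one]
  simp_rw [h1] at h
  rw [Finset.sum_add_distrib, ← Finset.mul_sum, Finset.sum_const, Finset.card_univ,
    Fintype.card_fin, nsmul_eq_mul, mul_one] at h
  rw [frameMoment]
  refine Eq.trans ?_ (h.trans ?_)
  · refine Finset.sum_congr rfl fun σ _ => ?_
    rw [Fin.prod_univ_succ]
    congr 1
    refine Finset.prod_congr rfl fun i _ => ?_
    rw [frameBlock, hb i.succ.succ (by simp), mul_zero, zero_mul, zero_sub, norm_neg]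
    by_cases hi : σ i.succ = i.succ
    · rw [if_pos hi, if_pos hi.symm, add_comm]
    · rw [if_neg hi, if_neg (Ne.symm hi)]
      simp
  · rw [frameBlock, if_pos rfl, Fin.succ_zero_eq_one]

theorem frameExponent_eq :
    frameExponent a z r l b = ‖z‖ ^ 2 + ‖a‖ ^ 2 * ‖r‖ ^ 2 * ‖inner ℂ (b 0) l‖ ^ 2 -
      (a * conj z * (inner ℂ l (b 0) * inner ℂ (b 0) r)
        + conj a * z * (inner ℂ r (b 0) * inner ℂ (b 0) l)).re := by
  have hr : ‖r‖ ^ 2 = ‖inner ℂ (b 0) r‖ ^ 2 + ∑ i : Fin n, ‖inner ℂ (b i.succ) r‖ ^ 2 := by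
    rw [← b.sum_sq_norm_inner_right r, Fin.sum_univ_succ]
  have h1 : conj a * z * (inner ℂ r (b 0) * inner ℂ (b 0) l) =
      conj (a * conj z * (inner ℂ l (b 0) * inner ℂ (b 0) r)) := by
    simp only [map_mul, Complex.conj_conj, inner_conj_symm]
    ring
  have h2 : conj z * (a * inner ℂ (b 0) r * conj (inner ℂ (b 0) l)) =
      a * conj z * (inner ℂ l (b 0) * inner ℂ (b 0) r) := by
    rw [inner_conj_symm]
    ring
  rw [h1, Complex.add_re, Complex.conj_re, frameExponent, norm_sub_rev, norm_sq_sub_eq, h2, hr]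
  simp only [norm_mul, RCLike.norm_conj, mul_pow]
  rw [← Finset.sum_mul, ← Finset.mul_sum]
  ring

/-- Parseval gives `r*r - |r*v|² = |b₁*r|²` and `l*l - |l*v|² = ∑_{j≥1} |b_j*l|²`, while `l*r = 1`
gives `1 - (l*v)(v*r) = (l*b₁)(b₁*r)`. The `Γ(N-2)` bracket becomes `|b₁*r|² ∑_{j≥2} |b_j*l|²`, and
the claim is linear in three consecutive values of `permSum`. -/
theorem rankOneDensity_eq (hlr : inner ℂ l r = 1)
    (hb : ∀ i : Fin (n + 1), 2 ≤ i.val → inner ℂ (b i) r = 0) :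
    rankOneDensity a r l z (b 0) = (Real.pi * n.factorial)⁻¹ *
      Real.exp (-frameExponent a z r l b) * frameMoment a z r l b := by
  have hr := b.sum_sq_norm_inner_right r
  have hl := b.sum_sq_norm_inner_right l
  have hs := b.sum_inner_mul_inner l r
  have hrv : ‖inner ℂ r (b 0)‖ = ‖inner ℂ (b 0) r‖ := norm_inner_symm _ _
  have hlv : ‖inner ℂ l (b 0)‖ = ‖inner ℂ (b 0) l‖ := norm_inner_symm _ _
  have hG : Real.Gamma ((n + 1 : ℕ) : ℝ) = n.factorial := by
    push_cast
    exact Real.Gamma_nat_eq_factorial n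
  have hx : (0 : ℝ) ≤ ‖z‖ ^ 2 := by positivity
  have hu : 1 - inner ℂ r (b 0) * inner ℂ (b 0) l =
      conj (1 - inner ℂ l (b 0) * inner ℂ (b 0) r) := by
    simp only [map_sub, map_one, map_mul, inner_conj_symm]
    ring
  have hT : (a * conj z * (1 - inner ℂ l (b 0) * inner ℂ (b 0) r)
      + conj a * z * (1 - inner ℂ r (b 0) * inner ℂ (b 0) l)).re =
      2 * (a * conj z * (1 - inner ℂ l (b 0) * inner ℂ (b 0) r)).re := by
    have : conj a * z * (1 - inner ℂ r (b 0) * inner ℂ (b 0) l) =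
        conj (a * conj z * (1 - inner ℂ l (b 0) * inner ℂ (b 0) r)) := by
      rw [hu]
      simp only [map_mul, Complex.conj_conj]
    rw [this, Complex.add_re, Complex.conj_re]
    ring
  have hE : Real.exp (-(‖a‖ ^ 2 * ‖r‖ ^ 2 * ‖inner ℂ (b 0) l‖ ^ 2)
      + (a * conj z * (inner ℂ l (b 0) * inner ℂ (b 0) r)
        + conj a * z * (inner ℂ r (b 0) * inner ℂ (b 0) l)).re) =
      Real.exp (-frameExponent a z r l b) * Real.exp (‖z‖ ^ 2) := by
    rw [← Real.exp_add, frameExponent_eq]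
    congr 1
    ring
  rw [rankOneDensity, hE, hG, hT, hrv, hlv, hu, RCLike.norm_conj, one_div]
  rw [← mul_assoc (Real.pi * _)⁻¹, mul_assoc (_ * _) (Real.exp (‖z‖ ^ 2))]
  congr 1
  -- For `N = 1` both brackets vanish, so the values of `upperGamma` at `0` and `-1` play no role.
  cases n with
  | zero =>
    simp only [Fin.sum_univ_succ, Finset.univ_eq_empty, Finset.sum_empty, add_zero] at hr hl hs
    rw [hlr] at hs
    simp [← hr, hs, frameMoment, upperGamma_one, ← Real.exp_add]
  | succ m =>
    rw [frameMoment_eq hb, norm_sq_sub_eq (a * inner ℂ (b 1) r * conj (inner ℂ (b 1) l)) z]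
    have h2 : ∀ j : Fin m, inner ℂ (b j.succ.succ) r = 0 := fun j => hb _ (by simp)
    simp only [Fin.sum_univ_succ, h2, Fin.succ_zero_eq_one, mul_zero, Finset.sum_const_zero,
      add_zero, norm_zero, ne_eq, OfNat.ofNat_ne_zero, not_false_eq_true, zero_pow] at hr hl hs
    rw [hlr] at hs
    have hu' : 1 - inner ℂ l (b 0) * inner ℂ (b 0) r = conj (inner ℂ (b 1) l) * inner ℂ (b 1) r := by
      rw [← hs, inner_conj_symm]
      ring
    rw [hu']
    have hre : conj z * (a * inner ℂ (b 1) r * conj (inner ℂ (b 1) l)) =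
        a * conj z * (conj (inner ℂ (b 1) l) * inner ℂ (b 1) r) := by ring
    rw [hre, ← hr, ← hl]
    simp only [norm_mul, RCLike.norm_conj, mul_pow]
    have hp1 := permSum_eq_upperGamma hx (m + 1)
    have hp0 := permSum_eq_upperGamma hx m
    have hp := permSum_succ' (‖z‖ ^ 2) m
    push_cast at hp1 ⊢
    have e1 : (m : ℝ) + 1 + 1 - 1 = m + 1 := by ring
    have e2 : (m : ℝ) + 1 + 1 - 2 = m := by ring
    rw [e1, e2]
    set T := (a * conj z * (conj (inner ℂ (b 1) l) * inner ℂ (b 1) r)).re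
    set x := ‖z‖ ^ 2
    set A := ‖a‖ ^ 2
    set ρ := ‖inner ℂ (b 1) r‖ ^ 2
    set L1 := ‖inner ℂ (b 1) l‖ ^ 2
    -- For `N = 2` the sum over `j ≥ 2` is empty, so `upperGamma 0` has coefficient zero.
    cases m with
    | zero =>
      simp only [Finset.univ_eq_empty, Finset.sum_empty]
      simp only [Nat.cast_zero, zero_mul, add_zero, zero_add] at hp hp0 hp1 ⊢
      linear_combination (-1 : ℝ) * hp1 + hp - (A * ρ * L1 - 2 * T) * hp0
    | succ k =>
      have hpk := permSum_eq_upperGamma hx k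
      rw [Nat.add_sub_cancel] at hp ⊢
      push_cast at hp hp0 hp1 hpk ⊢
      linear_combination (-1 : ℝ) * hp1 + hp - (A * ρ * (L1 + ∑ j : Fin (k + 1),
        ‖inner ℂ (b j.succ.succ) l‖ ^ 2) - 2 * T) * hp0 + A * x * ρ * (∑ j : Fin (k + 1),
        ‖inner ℂ (b j.succ.succ) l‖ ^ 2) * hpk

end Frame

end DeformedGinibre

namespace DeformedGinibre

variable {n : ℕ}

/-! ### Linear substitutions and unitary invariance on matrices -/

section MatrixMeasure

open scoped Kronecker Matrix

/-- The map `W ↦ Q * W * S` on rectangular matrices. -/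
def sandwich {k m : ℕ} (Q : Matrix (Fin k) (Fin k) ℂ) (S : Matrix (Fin m) (Fin m) ℂ) :
    (Fin k → Fin m → ℂ) →ₗ[ℂ] (Fin k → Fin m → ℂ) where
  toFun W := Q * Matrix.of W * S
  map_add' V W := by
    change Q * (Matrix.of V + Matrix.of W) * S = _
    rw [Matrix.mul_add, Matrix.add_mul]
    rfl
  map_smul' t W := by
    change Q * (t • Matrix.of W) * S = _
    rw [Matrix.mul_smul, Matrix.smul_mul]
    rfl

/-- Stacking columns turns the map into the Kronecker product of `Sᵀ` and `Q`. -/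
theorem det_sandwich {k m : ℕ} (Q : Matrix (Fin k) (Fin k) ℂ) (S : Matrix (Fin m) (Fin m) ℂ) :
    (sandwich Q S).det = S.det ^ k * Q.det ^ m := by
  let e : (Fin k → Fin m → ℂ) ≃ₗ[ℂ] (Fin m × Fin k → ℂ) := LinearEquiv.ofBijective
    { toFun := fun W => (Matrix.of W).vec
      map_add' := fun _ _ => rfl
      map_smul' := fun _ _ => rfl } Matrix.vec_bijective
  have h : (e : _ →ₗ[ℂ] _) ∘ₗ sandwich Q S ∘ₗ (e.symm : _ →ₗ[ℂ] _) =
      Matrix.toLin' (Sᵀ ⊗ₖ Q) := by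
    refine LinearMap.ext fun w => ?_
    obtain ⟨W, rfl⟩ := e.surjective w
    simp only [LinearMap.comp_apply, LinearEquiv.coe_coe, LinearEquiv.symm_apply_apply,
      Matrix.toLin'_apply]
    change (Q * Matrix.of W * S).vec = (Sᵀ ⊗ₖ Q).mulVec (Matrix.of W).vec
    rw [Matrix.kronecker_mulVec_vec, Matrix.transpose_transpose]
  rw [← LinearMap.det_conj (sandwich Q S) e, h, LinearMap.det_toLin', Matrix.det_kronecker,
    Matrix.det_transpose]
  simp

theorem lintegral_sandwich {k m : ℕ} {Q : Matrix (Fin k) (Fin k) ℂ}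
    {S : Matrix (Fin m) (Fin m) ℂ} (hQ : ‖Q.det‖ = 1) (hS : S.det ≠ 0)
    (R₀ : Fin k → Fin m → ℂ) {f : (Fin k → Fin m → ℂ) → ENNReal} (hf : Measurable f) :
    ∫⁻ R, f R = ENNReal.ofReal (‖S.det‖ ^ (2 * k)) * ∫⁻ W, f (sandwich Q S W + R₀) := by
  have hdet : ((sandwich Q S).restrictScalars ℝ).det = ‖S.det‖ ^ (2 * k) := by
    rw [LinearMap.det_restrictScalars, Algebra.norm_complex_apply, Complex.normSq_eq_norm_sq,
      det_sandwich, norm_mul, norm_pow, norm_pow, hQ, one_pow, mul_one, ← pow_mul, mul_comm k]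
  have hpos : 0 < ‖S.det‖ ^ (2 * k) := by positivity
  have hmap := Measure.map_linearMap_addHaar_eq_smul_addHaar
    (volume : Measure (Fin k → Fin m → ℂ)) (f := (sandwich Q S).restrictScalars ℝ)
    (hdet ▸ hpos.ne')
  have hcont : Continuous ((sandwich Q S).restrictScalars ℝ) :=
    LinearMap.continuous_of_finiteDimensional _
  have h1 : ∫⁻ W, f (sandwich Q S W + R₀) =
      ∫⁻ W, f (W + R₀) ∂(volume.map ((sandwich Q S).restrictScalars ℝ)) := by
    have hf' : Measurable fun W => f (W + R₀) := hf.comp (measurable_add_const R₀)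
    rw [lintegral_map hf' hcont.measurable]
    rfl
  rw [h1, hmap, lintegral_smul_measure, lintegral_add_right_eq_self, hdet, smul_eq_mul,
    ← mul_assoc, ← ENNReal.ofReal_mul hpos.le, abs_of_pos (inv_pos.2 hpos),
    mul_inv_cancel₀ hpos.ne', ENNReal.ofReal_one, one_mul]

theorem prod_gaussDensity {k m : ℕ} (X : Fin k → Fin m → ℂ) :
    ∏ i, ∏ j, gaussDensity (X i j) =
      ENNReal.ofReal ((Real.pi⁻¹ ^ m) ^ k * Real.exp (-∑ i, ∑ j, ‖X i j‖ ^ 2)) := by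
  have h : ∀ i j, 0 ≤ Real.pi⁻¹ * Real.exp (-‖X i j‖ ^ 2) := fun i j => by positivity
  simp only [gaussDensity]
  simp_rw [← ENNReal.ofReal_prod_of_nonneg fun j _ => h _ j]
  rw [← ENNReal.ofReal_prod_of_nonneg fun i _ => Finset.prod_nonneg fun j _ => h i j]
  simp only [Finset.prod_mul_distrib, Finset.prod_const, Finset.card_univ, Fintype.card_fin,
    ← Real.exp_sum, Finset.sum_neg_distrib]

theorem sum_norm_sq_eq_trace {k m : ℕ} (X : Matrix (Fin k) (Fin m) ℂ) :
    ((∑ i, ∑ j, ‖X i j‖ ^ 2 : ℝ) : ℂ) = (Xᴴ * X).trace := by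
  rw [Finset.sum_comm]
  simp only [Matrix.trace, Matrix.diag_apply, Matrix.mul_apply, Matrix.conjTranspose_apply,
    Complex.ofReal_sum]
  refine Finset.sum_congr rfl fun j _ => Finset.sum_congr rfl fun i _ => ?_
  rw [← Complex.normSq_eq_norm_sq, Complex.normSq_eq_conj_mul_self]
  rfl

theorem prod_gaussDensity_conj {k : ℕ} {Q : Matrix (Fin k) (Fin k) ℂ} (hQ : Qᴴ * Q = 1)
    (B : Matrix (Fin k) (Fin k) ℂ) :
    ∏ i, ∏ j, gaussDensity ((Q * B * Qᴴ) i j) = ∏ i, ∏ j, gaussDensity (B i j) := by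
  have h : ∑ i, ∑ j, ‖(Q * B * Qᴴ) i j‖ ^ 2 = ∑ i, ∑ j, ‖B i j‖ ^ 2 := by
    rw [← Complex.ofReal_inj, sum_norm_sq_eq_trace, sum_norm_sq_eq_trace]
    have : (Q * B * Qᴴ)ᴴ * (Q * B * Qᴴ) = Q * (Bᴴ * B * Qᴴ) := by
      simp only [Matrix.conjTranspose_mul, Matrix.conjTranspose_conjTranspose]
      calc Q * (Bᴴ * Qᴴ) * (Q * B * Qᴴ) = Q * (Bᴴ * (Qᴴ * Q) * B * Qᴴ) := by
            simp only [Matrix.mul_assoc]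
        _ = _ := by rw [hQ, Matrix.mul_one]
    rw [this, Matrix.trace_mul_comm, Matrix.mul_assoc, hQ, Matrix.mul_one]
  refine (prod_gaussDensity _).trans (Eq.trans ?_ (prod_gaussDensity _).symm)
  rw [h]

theorem norm_det_of_unitary {k : ℕ} {Q : Matrix (Fin k) (Fin k) ℂ} (hQ : Qᴴ * Q = 1) :
    ‖Q.det‖ = 1 := by
  have h := congrArg Matrix.det hQ
  rw [Matrix.det_mul, Matrix.det_conjTranspose, Matrix.det_one] at h
  have h1 := congrArg norm h
  rw [norm_mul, norm_star, norm_one, ← sq] at h1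
  exact (pow_eq_one_iff_of_nonneg (norm_nonneg _) two_ne_zero).1 h1

/-- The adjugate of the unitary `Qᴴ` is `det Qᴴ` times `Q`; its entry `(0, 0)` is the minor in
question. -/
theorem norm_det_submatrix_of_unitary {Q : Matrix (Fin (n + 1)) (Fin (n + 1)) ℂ}
    (hQ : Qᴴ * Q = 1) : ‖(Qᴴ.submatrix Fin.succ Fin.succ).det‖ = ‖Q 0 0‖ := by
  have h1 : Qᴴ.adjugate = Qᴴ.det • Q := by
    calc Qᴴ.adjugate = Qᴴ.adjugate * (Qᴴ * Q) := by rw [hQ, Matrix.mul_one]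
      _ = _ := by rw [← Matrix.mul_assoc, Matrix.adjugate_mul, Matrix.smul_mul, Matrix.one_mul]
  have h2 := congrFun (congrFun h1 0) 0
  rw [Matrix.adjugate_fin_succ_eq_det_submatrix] at h2
  simp only [Fin.val_zero, add_zero, pow_zero, one_mul, Fin.succAbove_zero, Matrix.smul_apply,
    smul_eq_mul] at h2
  change (Qᴴ.submatrix Fin.succ Fin.succ).det = _ at h2
  rw [h2, norm_mul, Matrix.det_conjTranspose, norm_star, norm_det_of_unitary hQ, one_mul]

end MatrixMeasure

/-! ### Block triangular form in a unitary frame -/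

section FrameMatrix

open scoped Matrix

/-- The unitary matrix whose columns are the vectors of an orthonormal basis. -/
def frameMatrix (b : OrthonormalBasis (Fin (n + 1)) ℂ (CVec (n + 1))) :
    Matrix (Fin (n + 1)) (Fin (n + 1)) ℂ := Matrix.of fun i j => b j i

variable (b : OrthonormalBasis (Fin (n + 1)) ℂ (CVec (n + 1)))

theorem conjTranspose_frameMatrix_mulVec (w : CVec (n + 1)) (i : Fin (n + 1)) :
    ((frameMatrix b)ᴴ.mulVec w.ofLp) i = inner ℂ (b i) w := by
  rw [EuclideanSpace.inner_eq_star_dotProduct, dotProduct_comm]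
  rfl

theorem frameMatrix_unitary : (frameMatrix b)ᴴ * frameMatrix b = 1 := by
  ext i j
  have h := conjTranspose_frameMatrix_mulVec b (b j) i
  rw [orthonormal_iff_ite.1 b.orthonormal i j] at h
  rw [Matrix.one_apply, ← h]
  rfl

theorem frameMatrix_unitary' : frameMatrix b * (frameMatrix b)ᴴ = 1 :=
  mul_eq_one_comm.1 (frameMatrix_unitary b)

theorem frameMatrix_rankOne (a : ℂ) (r l : CVec (n + 1)) (i j : Fin (n + 1)) :
    ((frameMatrix b)ᴴ * rankOne a r l * frameMatrix b) i j =
      a * inner ℂ (b i) r * conj (inner ℂ (b j) l) := by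
  have h : (frameMatrix b)ᴴ * rankOne a r l * frameMatrix b = a • Matrix.vecMulVec
      ((frameMatrix b)ᴴ.mulVec r.ofLp) (star ((frameMatrix b)ᴴ.mulVec l.ofLp)) := by
    rw [rankOne, Matrix.mul_smul, Matrix.smul_mul, Matrix.mul_vecMulVec, Matrix.vecMulVec_mul,
      Matrix.star_mulVec, Matrix.conjTranspose_conjTranspose]
  rw [h, Matrix.smul_apply, Matrix.vecMulVec_apply, conjTranspose_frameMatrix_mulVec, Pi.star_apply,
    conjTranspose_frameMatrix_mulVec, smul_eq_mul, mul_assoc]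
  rfl

/-- The matrix with first column `z e₀` and other columns `W`. -/
def blockMat (z : ℂ) (W : Fin (n + 1) → Fin n → ℂ) : Matrix (Fin (n + 1)) (Fin (n + 1)) ℂ :=
  toMat (Pi.single 0 z, W)

theorem blockMat_mulVec (z : ℂ) (W : Fin (n + 1) → Fin n → ℂ) :
    (blockMat z W).mulVec (Pi.single 0 1) = z • Pi.single 0 1 := by
  ext i
  rw [Matrix.mulVec_single_one]
  refine Fin.cases ?_ (fun j => ?_) i <;> simp [blockMat]

theorem eval_derivative_charpoly_blockMat (z : ℂ) (W : Fin (n + 1) → Fin n → ℂ) :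
    (blockMat z W).charpoly.derivative.eval z =
      (Matrix.scalar (Fin n) z - Matrix.of fun (i j : Fin n) => W i.succ j).det := by
  rw [eval_derivative_charpoly (i := 0) (Pi.single_eq_same _ _) (blockMat_mulVec z W),
    Matrix.det_succ_column_zero, Fin.sum_univ_succ, Finset.sum_eq_zero, add_zero]
  · simp only [Fin.val_zero, pow_zero, one_mul, Matrix.updateCol_self, Pi.single_eq_same]
    congr 1
    ext i j
    simp [blockMat, Matrix.diagonal_apply, Fin.succ_ne_zero]
  · intro i _
    simp

theorem blockMat_eq_add (z : ℂ) (W : Fin (n + 1) → Fin n → ℂ) :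
    blockMat z W = blockMat z 0 + toMat (0, W) := by
  ext i j
  refine Fin.cases ?_ (fun k => ?_) j <;> simp [blockMat]

/-- The last columns of `Q * blockMat z W * Qᴴ`. -/
theorem conj_blockMat_succ (Q : Matrix (Fin (n + 1)) (Fin (n + 1)) ℂ) (z : ℂ)
    (W : Fin (n + 1) → Fin n → ℂ) (i : Fin (n + 1)) (j : Fin n) :
    (Q * blockMat z W * Qᴴ) i j.succ =
      (sandwich Q (Qᴴ.submatrix Fin.succ Fin.succ) W +
        fun (i : Fin (n + 1)) (j : Fin n) =>
          (Q * blockMat z 0 * Qᴴ : Matrix (Fin (n + 1)) (Fin (n + 1)) ℂ) i j.succ) i j := by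
  rw [blockMat_eq_add z W, Matrix.mul_add, Matrix.add_mul, Matrix.add_apply, add_comm]
  change _ = (Q * Matrix.of W * Qᴴ.submatrix Fin.succ Fin.succ) i j + _
  congr 1
  rw [Matrix.mul_assoc, Matrix.mul_assoc, Matrix.mul_apply, Matrix.mul_apply]
  refine Finset.sum_congr rfl fun k _ => ?_
  rw [Matrix.mul_apply, Matrix.mul_apply, Fin.sum_univ_succ]
  simp

end FrameMatrix

end DeformedGinibre

namespace DeformedGinibre

variable {n : ℕ}

/-! ### Integration over all matrices with a given eigenpair -/

section Fiber

open scoped Matrix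

variable {a z : ℂ} {r l : CVec (n + 1)} {b : OrthonormalBasis (Fin (n + 1)) ℂ (CVec (n + 1))}

theorem lintegral_frameBlock (hb : ∀ i : Fin (n + 1), 2 ≤ i.val → inner ℂ (b i) r = 0) :
    ∫⁻ G : Fin n → Fin n → ℂ,
      ENNReal.ofReal (‖(Matrix.of fun i j => frameBlock a z r l b i j + G i j).det‖ ^ 2)
        ∂(ginibre n) = ENNReal.ofReal (frameMoment a z r l b) := by
  rw [← ofReal_integral_eq_lintegral_ofReal integrable_norm_sq_det
    (Filter.Eventually.of_forall fun _ => by positivity)]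
  congr 1
  cases n with
  | zero => simp [frameMoment]
  | succ m =>
    refine integral_norm_sq_det 0 fun i hi j k hjk => ?_
    have h0 : inner ℂ (b i.succ) r = 0 := hb _ (by
      have := Fin.pos_of_ne_zero hi
      rw [Fin.lt_def] at this
      simp only [Fin.val_succ, Fin.val_zero] at this ⊢
      omega)
    simp only [frameBlock, h0, mul_zero, zero_mul, zero_sub]
    by_cases hij : i = j
    · have hik : i ≠ k := fun h => hjk (hij.symm.trans h)
      simp [hik]
    · simp [hij]

theorem measurePreserving_tail (μ : Measure (Fin n → ℂ)) [IsProbabilityMeasure μ] :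
    MeasurePreserving (fun (x : Fin (n + 1) → Fin n → ℂ) (i : Fin n) => x i.succ)
      (Measure.pi fun _ => μ) (Measure.pi fun _ => μ) := by
  have h := (measurePreserving_piFinSuccAbove (fun _ : Fin (n + 1) => μ) 0)
  exact measurePreserving_snd.comp h

/-- The determinant does not involve the top row of `W`, which integrates to one. Translating by the
mean leaves a Gaussian determinant with mean `frameBlock`, up to a sign that the modulus removes. -/
theorem lintegral_block (hb : ∀ i : Fin (n + 1), 2 ≤ i.val → inner ℂ (b i) r = 0) :
    ∫⁻ W : Fin (n + 1) → Fin n → ℂ,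
      (∏ i, ∏ j, gaussDensity (W i j - a * inner ℂ (b i) r * conj (inner ℂ (b j.succ) l))) *
        ENNReal.ofReal (‖(Matrix.scalar (Fin n) z -
          Matrix.of fun (i j : Fin n) => W i.succ j).det‖ ^ 2) =
      ENNReal.ofReal (frameMoment a z r l b) := by
  set B : Fin (n + 1) → Fin n → ℂ :=
    fun i j => a * inner ℂ (b i) r * conj (inner ℂ (b j.succ) l) with hB
  set F : (Fin n → Fin n → ℂ) → ENNReal := fun G =>
    ENNReal.ofReal (‖(Matrix.of fun i j => frameBlock a z r l b i j + G i j).det‖ ^ 2) with hF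
  have hFm : Measurable F := by
    refine ENNReal.measurable_ofReal.comp (Continuous.measurable ?_)
    refine (Continuous.norm (Continuous.matrix_det ?_)).pow 2
    exact continuous_matrix fun i j => by simp only [Matrix.of_apply]; fun_prop
  rw [← lintegral_frameBlock hb, ginibre, ← (measurePreserving_tail _).lintegral_comp hFm,
    pi_pi_complexNormal, lintegral_withDensity_eq_lintegral_mul]
  · rw [← lintegral_add_right_eq_self _ B]
    refine lintegral_congr fun W => ?_
    simp only [Pi.mul_apply, Pi.add_apply]
    congr 1
    · simp only [hB, add_sub_cancel_right]
    · rw [hF]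
      have hdet : Matrix.scalar (Fin n) z - Matrix.of (fun (i j : Fin n) => W i.succ j + B i.succ j)
          = -(Matrix.of fun i j => frameBlock a z r l b i j + W i.succ j) := by
        ext i j
        simp only [Matrix.sub_apply, Matrix.scalar_apply, Matrix.diagonal_apply, Matrix.of_apply,
          Matrix.neg_apply, frameBlock, hB]
        ring
      rw [hdet, Matrix.det_neg, norm_mul, norm_pow, norm_neg, norm_one, one_pow, one_mul]
  · exact Finset.measurable_prod _ fun i _ => Finset.measurable_prod _ fun j _ =>
      measurable_gaussDensity.comp ((measurable_pi_apply j).comp (measurable_pi_apply i))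
  · exact hFm.comp (measurePreserving_tail (Measure.pi fun _ => complexNormal)).measurable

/-- The density of the parameters of a Gaussian matrix with mean `A`, in the coordinates of
`chart`. -/
def chartDensity (A : Matrix (Fin (n + 1)) (Fin (n + 1)) ℂ) (p : Par n) : ENNReal :=
  (∏ i, ∏ j, gaussDensity ((toMat (chart p) - A) i j)) *
    ENNReal.ofReal |(fderiv ℝ chart p).det|

theorem measurable_chartDensity (A : Matrix (Fin (n + 1)) (Fin (n + 1)) ℂ) :
    Measurable (chartDensity A) := by
  refine Measurable.mul ?_ ?_
  · refine Finset.measurable_prod _ fun i _ => Finset.measurable_prod _ fun j _ =>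
      measurable_gaussDensity.comp ?_
    have h1 : Measurable fun p : Par n => parEquiv n (chart p) i j :=
      (measurable_pi_apply j).comp ((measurable_pi_apply i).comp
        ((parEquiv n).measurable.comp differentiable_chart.continuous.measurable))
    have h2 : (fun p : Par n => (toMat (chart p) - A) i j) =
        fun p => parEquiv n (chart p) i j - A i j := funext fun p => by
      rw [parEquiv_apply]
      rfl
    rw [h2]
    exact h1.sub_const _
  · exact (ContinuousLinearMap.continuous_det.comp
      continuous_fderiv_chart).abs.measurable.ennreal_ofReal

/-- The matrices with the given eigenpair are `Q * blockMat z W * Qᴴ`, whose last columns are `Q W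
S` plus a constant, where `S` is the lower right block of `Qᴴ`. Since `|det S| = |Q 0 0| = ν⁻¹` and
`W` has `n + 1` rows, the real Jacobian is `ν^(-2(n+1))`. Unitary invariance splits the Gaussian
weight into column `0` and the rest. -/
theorem lintegral_chart_fiber {c : Fin (n + 1) → ℂ} (hb0 : b 0 = chartSphere c)
    (hb : ∀ i : Fin (n + 1), 2 ≤ i.val → inner ℂ (b i) r = 0) :
    ∫⁻ R : Fin (n + 1) → Fin n → ℂ, chartDensity (rankOne a r l) (c, R) =
      ENNReal.ofReal ((‖(WithLp.toLp 2 (chartVec c) : CVec (n + 1))‖⁻¹) ^ (2 * (n + 1)) *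
        (Real.pi⁻¹ ^ (n + 1) * Real.exp (-frameExponent a (c 0) r l b)) *
          frameMoment a (c 0) r l b) := by
  set Q := frameMatrix b with hQdef
  set S := Qᴴ.submatrix Fin.succ Fin.succ with hS
  set ν := ‖(WithLp.toLp 2 (chartVec c) : CVec (n + 1))‖ with hν
  have hQ := frameMatrix_unitary b
  have hQ' := frameMatrix_unitary' b
  rw [← hQdef] at hQ hQ'
  have hν0 : ν ≠ 0 := norm_ne_zero_iff.2 (toLp_chartVec_ne_zero c)
  have hQ0 : ∀ i, Q i 0 = (ν⁻¹ : ℂ) * chartVec c i := fun i => by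
    change b 0 i = _
    rw [hb0, ← Complex.ofReal_inv]
    rfl
  have hS1 : ‖S.det‖ = ν⁻¹ := by
    rw [hS, norm_det_submatrix_of_unitary hQ, hQ0, chartVec_zero, mul_one, norm_inv,
      Complex.norm_real, hν, norm_norm]
  have hvec : chartVec c = (ν : ℂ) • Q.mulVec (Pi.single 0 1) := by
    ext i
    rw [Matrix.mulVec_single_one, Pi.smul_apply, Matrix.col_apply, hQ0, smul_eq_mul,
      mul_inv_cancel_left₀ (by exact_mod_cast hν0)]
  have hf : Measurable fun R : Fin (n + 1) → Fin n → ℂ => chartDensity (rankOne a r l) (c, R) :=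
    (measurable_chartDensity (rankOne a r l)).comp measurable_prodMk_left
  rw [lintegral_sandwich (norm_det_of_unitary hQ) (S := S)
    (norm_ne_zero_iff.1 (hS1 ▸ inv_ne_zero hν0))
    (fun (i : Fin (n + 1)) (j : Fin n) =>
      (Q * blockMat (c 0) 0 * Qᴴ : Matrix (Fin (n + 1)) (Fin (n + 1)) ℂ) i j.succ) hf, hS1]
  have key : ∀ W : Fin (n + 1) → Fin n → ℂ,
      toMat (chart (c, sandwich Q S W + fun (i : Fin (n + 1)) (j : Fin n) =>
        (Q * blockMat (c 0) 0 * Qᴴ : Matrix (Fin (n + 1)) (Fin (n + 1)) ℂ) i j.succ)) =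
      Q * blockMat (c 0) W * Qᴴ := by
    intro W
    set R := sandwich Q S W + fun (i : Fin (n + 1)) (j : Fin n) =>
        (Q * blockMat (c 0) 0 * Qᴴ : Matrix (Fin (n + 1)) (Fin (n + 1)) ℂ) i j.succ with hR
    have hy : toMat ((fun i => (Q * blockMat (c 0) W * Qᴴ) i 0), R) =
        Q * blockMat (c 0) W * Qᴴ := by
      ext i j
      refine Fin.cases rfl (fun k => ?_) j
      rw [toMat_succ, conj_blockMat_succ]
    rw [← hy]
    congr 1
    refine chart_eq_iff.2 ⟨rfl, ?_⟩
    rw [hy]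
    change (Q * blockMat (c 0) W * Qᴴ).mulVec (chartVec c) = c 0 • chartVec c
    rw [hvec, Matrix.mulVec_smul, Matrix.mulVec_mulVec, Matrix.mul_assoc, hQ, Matrix.mul_one,
      ← Matrix.mulVec_mulVec, blockMat_mulVec, Matrix.mulVec_smul, smul_comm]
  have hint : ∀ W : Fin (n + 1) → Fin n → ℂ,
      (∏ i, ∏ j, gaussDensity ((Q * blockMat (c 0) W * Qᴴ - rankOne a r l) i j)) *
        ENNReal.ofReal (‖(Q * blockMat (c 0) W * Qᴴ).charpoly.derivative.eval (c 0)‖ ^ 2) =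
      (∏ i, gaussDensity ((Pi.single 0 (c 0) : Fin (n + 1) → ℂ) i -
          a * inner ℂ (b i) r * conj (inner ℂ (b 0) l))) *
        ((∏ i, ∏ j : Fin n,
          gaussDensity (W i j - a * inner ℂ (b i) r * conj (inner ℂ (b j.succ) l))) *
        ENNReal.ofReal (‖(Matrix.scalar (Fin n) (c 0) -
          Matrix.of fun (i j : Fin n) => W i.succ j).det‖ ^ 2)) := by
    intro W
    have h1 : Q * blockMat (c 0) W * Qᴴ - rankOne a r l =
        Q * (blockMat (c 0) W - Qᴴ * rankOne a r l * Q) * Qᴴ := by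
      rw [Matrix.mul_sub, Matrix.sub_mul]
      congr 1
      calc rankOne a r l = (Q * Qᴴ) * rankOne a r l * (Q * Qᴴ) := by
            rw [hQ', Matrix.one_mul, Matrix.mul_one]
        _ = _ := by simp only [Matrix.mul_assoc]
    have h2 : (Q * blockMat (c 0) W * Qᴴ).charpoly = (blockMat (c 0) W).charpoly := by
      rw [Matrix.mul_assoc, Matrix.charpoly_mul_comm, Matrix.mul_assoc, hQ, Matrix.mul_one]
    rw [h1, prod_gaussDensity_conj hQ, h2, eval_derivative_charpoly_blockMat, ← mul_assoc,
      ← Finset.prod_mul_distrib]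
    congr 1
    refine Finset.prod_congr rfl fun i _ => ?_
    rw [Fin.prod_univ_succ]
    simp only [Matrix.sub_apply, hQdef, frameMatrix_rankOne]
    rfl
  have hcol : (∏ i, gaussDensity ((Pi.single 0 (c 0) : Fin (n + 1) → ℂ) i -
      a * inner ℂ (b i) r * conj (inner ℂ (b 0) l))) =
      ENNReal.ofReal (Real.pi⁻¹ ^ (n + 1) * Real.exp (-frameExponent a (c 0) r l b)) := by
    simp only [gaussDensity]
    rw [← ENNReal.ofReal_prod_of_nonneg fun i _ => by positivity]
    simp only [Finset.prod_mul_distrib, Finset.prod_const, Finset.card_univ, Fintype.card_fin,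
      ← Real.exp_sum, Finset.sum_neg_distrib]
    congr 4
    rw [Fin.sum_univ_succ, frameExponent]
    congr 1
    refine Finset.sum_congr rfl fun i _ => ?_
    rw [Pi.single_eq_of_ne (Fin.succ_ne_zero i), zero_sub, norm_neg]
  have hcongr : ∀ W : Fin (n + 1) → Fin n → ℂ,
      chartDensity (rankOne a r l)
        (c, sandwich Q S W + fun (i : Fin (n + 1)) (j : Fin n) =>
          (Q * blockMat (c 0) 0 * Qᴴ : Matrix (Fin (n + 1)) (Fin (n + 1)) ℂ) i j.succ) = _ :=
    fun W => by
      rw [chartDensity, abs_det_fderiv_chart, key W]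
  rw [lintegral_congr fun W => (hcongr W).trans (hint W), lintegral_const_mul', lintegral_block hb, hcol,
    ← ENNReal.ofReal_mul (by positivity), ← ENNReal.ofReal_mul (by positivity)]
  · congr 1
    ring
  · rw [hcol]
    exact ENNReal.ofReal_ne_top

end Fiber

end DeformedGinibre

namespace DeformedGinibre

variable {n : ℕ}

/-! ### The uniform measure as the direction of a Gaussian vector -/

section Direction

open Classical in
/-- The unit vector in the direction of `x`, with an arbitrary value at `x = 0`. -/
def direction (x : CVec (n + 1)) : CSphere (n + 1) :=
  ⟨if x = 0 then (chartSphere 0 : CSphere (n + 1)) else ‖x‖⁻¹ • x, by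
    split_ifs with h
    · exact (chartSphere 0).2
    · rw [mem_sphere_zero_iff_norm, norm_smul, norm_inv, norm_norm,
        inv_mul_cancel₀ (norm_ne_zero_iff.2 h)]⟩

theorem coe_direction {x : CVec (n + 1)} (hx : x ≠ 0) :
    (direction x : CVec (n + 1)) = ‖x‖⁻¹ • x := by
  simp [direction, hx]

theorem measurable_direction : Measurable (direction (n := n)) := by
  classical
  exact (Measurable.ite (measurableSet_singleton 0) measurable_const
    (measurable_norm.inv.smul measurable_id)).subtype_mk

theorem lintegral_direction (f : CSphere (n + 1) → ENNReal) (hf : Measurable f) :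
    ∫⁻ x : CVec (n + 1), f (direction x) * ENNReal.ofReal (Real.exp (-‖x‖ ^ 2)) =
      (∫⁻ v, f v ∂(volume : Measure (CVec (n + 1))).toSphere) *
        ∫⁻ y, ENNReal.ofReal (Real.exp (-(y : ℝ) ^ 2))
          ∂Measure.volumeIoiPow (Module.finrank ℝ (CVec (n + 1)) - 1) := by
  have hexp : Measurable fun y : Set.Ioi (0 : ℝ) => ENNReal.ofReal (Real.exp (-(y : ℝ) ^ 2)) := by
    fun_prop
  have hprod : Measurable fun q : CSphere (n + 1) × Set.Ioi (0 : ℝ) =>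
      f q.1 * ENNReal.ofReal (Real.exp (-(q.2 : ℝ) ^ 2)) :=
    (hf.comp measurable_fst).mul (hexp.comp measurable_snd)
  rw [← lintegral_prod_mul hf.aemeasurable hexp.aemeasurable,
    ← (Measure.measurePreserving_homeomorphUnitSphereProd
      (volume : Measure (CVec (n + 1)))).lintegral_comp hprod,
    ← restrict_compl_singleton (μ := (volume : Measure (CVec (n + 1)))) 0,
    ← lintegral_subtype_comap (measurableSet_singleton (0 : CVec (n + 1))).compl,
    restrict_compl_singleton]
  refine lintegral_congr fun x => ?_
  have hx : (x : CVec (n + 1)) ≠ 0 := x.2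
  congr 2
  · exact Subtype.ext ((coe_direction hx).trans (homeomorphUnitSphereProd_apply_fst_coe _ x).symm)
  · rw [homeomorphUnitSphereProd_apply_snd_coe]

theorem prod_gaussDensity_apply {k : ℕ} (x : Fin k → ℂ) :
    ∏ i, gaussDensity (x i) = ENNReal.ofReal (Real.pi⁻¹ ^ k) *
      ENNReal.ofReal (Real.exp (-‖WithLp.toLp 2 x‖ ^ 2)) := by
  simp only [gaussDensity]
  rw [← ENNReal.ofReal_prod_of_nonneg fun i _ => by positivity,
    ← ENNReal.ofReal_mul (by positivity), Finset.prod_mul_distrib, ← Real.exp_sum,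
    Finset.sum_neg_distrib, EuclideanSpace.norm_sq_eq]
  simp

theorem lintegral_haarSphere {f : CSphere (n + 1) → ENNReal} (hf : Measurable f) :
    ∫⁻ v, f v ∂haarSphere (n + 1) =
      ∫⁻ x : Fin (n + 1) → ℂ, (∏ i, gaussDensity (x i)) * f (direction (WithLp.toLp 2 x)) := by
  set e : (Fin (n + 1) → ℂ) ≃L[ℝ] CVec (n + 1) :=
    (PiLp.continuousLinearEquiv 2 ℝ fun _ : Fin (n + 1) => ℂ).symm with he
  have heq : ∀ x, e x = WithLp.toLp 2 x := fun _ => rfl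
  have : (Measure.map e volume).IsAddHaarMeasure := e.isAddHaarMeasure_map volume
  set κ := Measure.addHaarScalarFactor (volume : Measure (CVec (n + 1))) (Measure.map e volume)
    with hκ
  have hvol : (volume : Measure (CVec (n + 1))) = κ • Measure.map e volume :=
    Measure.isAddLeftInvariant_eq_smul _ _
  have hκ0 : κ ≠ 0 := (Measure.addHaarScalarFactor_pos_of_isAddHaarMeasure _ _).ne'
  set K := ∫⁻ y, ENNReal.ofReal (Real.exp (-(y : ℝ) ^ 2))
    ∂Measure.volumeIoiPow (Module.finrank ℝ (CVec (n + 1)) - 1) with hK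
  set p := ENNReal.ofReal (Real.pi⁻¹ ^ (n + 1)) with hp
  have hp0 : p ≠ 0 := (ENNReal.ofReal_pos.2 (by positivity)).ne'
  have main : ∀ f : CSphere (n + 1) → ENNReal, Measurable f →
      (∫⁻ v, f v ∂(volume : Measure (CVec (n + 1))).toSphere) * (p * K) =
        κ * ∫⁻ x : Fin (n + 1) → ℂ,
          (∏ i, gaussDensity (x i)) * f (direction (WithLp.toLp 2 x)) := by
    intro f hf
    have hm : Measurable fun x : CVec (n + 1) =>
        f (direction x) * ENNReal.ofReal (Real.exp (-‖x‖ ^ 2)) :=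
      (hf.comp measurable_direction).mul (by fun_prop)
    rw [mul_left_comm, hK, ← lintegral_direction f hf, hvol, lintegral_smul_measure,
      lintegral_map hm e.continuous.measurable, ENNReal.smul_def, smul_eq_mul, mul_left_comm,
      ← lintegral_const_mul' _ _ ENNReal.ofReal_ne_top]
    congr 1
    refine lintegral_congr fun x => ?_
    rw [heq, prod_gaussDensity_apply, mul_comm (f _), mul_assoc]
  -- Taking `f = 1` relates the total surface mass, the radial integral and the ratio of the two
  -- Lebesgue measures, so none of them has to be computed.
  have hone := main 1 measurable_one
  have hmass : ∫⁻ x : Fin (n + 1) → ℂ, ∏ i, gaussDensity (x i) = 1 := by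
    have h := congrArg (fun m : Measure (Fin (n + 1) → ℂ) => m Set.univ)
      (pi_complexNormal (n + 1))
    simp only [withDensity_apply _ MeasurableSet.univ, Measure.restrict_univ] at h
    rw [← h, measure_univ]
  simp only [Pi.one_apply, mul_one, lintegral_one, hmass] at hone
  set J := (volume : Measure (CVec (n + 1))).toSphere Set.univ with hJ
  have hκ0' : (κ : ENNReal) ≠ 0 := by simpa using hκ0
  have hJ0 : J ≠ 0 := left_ne_zero_of_mul (hone ▸ hκ0')
  have hJt : J ≠ ⊤ := measure_ne_top _ _
  have hpK0 : p * K ≠ 0 := right_ne_zero_of_mul (hone ▸ hκ0')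
  have hpKt : p * K ≠ ⊤ := fun h => by
    rw [h, ENNReal.mul_top hJ0] at hone
    exact ENNReal.coe_ne_top hone.symm
  have h := main f hf
  rw [← hone, mul_right_comm] at h
  rw [haarSphere, lintegral_smul_measure, smul_eq_mul,
    (ENNReal.mul_left_inj hpK0 hpKt).1 h, ← mul_assoc, ENNReal.inv_mul_cancel hJ0 hJt, one_mul]

end Direction

/-! ### Polar coordinates in the complex plane -/

section Polar

theorem setLIntegral_eq_of_periodic {f : ℝ → ENNReal} (hf : Function.Periodic f (2 * Real.pi)) :
    ∫⁻ θ in Set.Ioo (-Real.pi) Real.pi, f θ = ∫⁻ θ in Set.Ico 0 (2 * Real.pi), f θ := by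
  have h1 := isAddFundamentalDomain_Ioc Real.two_pi_pos (-Real.pi) (volume : Measure ℝ)
  have h2 := isAddFundamentalDomain_Ioc Real.two_pi_pos 0 (volume : Measure ℝ)
  have h := h1.setLIntegral_eq h2 f (by
    rintro ⟨g, hg⟩ x
    obtain ⟨k, rfl⟩ := AddSubgroup.mem_zmultiples_iff.1 hg
    change f (k • (2 * Real.pi) + x) = f x
    rw [add_comm]
    exact hf.zsmul k x)
  rw [zero_add, show -Real.pi + 2 * Real.pi = Real.pi by ring] at h
  rwa [setLIntegral_congr Ioo_ae_eq_Ioc, setLIntegral_congr Ico_ae_eq_Ioc]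

theorem lintegral_radial {b : ℝ} (hb : 0 < b) (n : ℕ) :
    ∫⁻ s in Set.Ioi (0 : ℝ), ENNReal.ofReal (s ^ (2 * n + 1) * Real.exp (-(b * s ^ 2))) =
      ENNReal.ofReal (n.factorial / 2 * b⁻¹ ^ (n + 1)) := by
  have hint := integrableOn_rpow_mul_exp_neg_mul_sq hb (s := ((2 * n + 1 : ℕ) : ℝ))
    (by push_cast; linarith [(Nat.cast_nonneg n : (0 : ℝ) ≤ n)])
  have hval := integral_rpow_mul_exp_neg_mul_rpow (p := 2) (q := ((2 * n + 1 : ℕ) : ℝ)) (b := b)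
    two_pos (by push_cast; linarith [(Nat.cast_nonneg n : (0 : ℝ) ≤ n)]) hb
  simp only [Real.rpow_natCast, neg_mul, Real.rpow_two] at hint hval
  rw [← ofReal_integral_eq_lintegral_ofReal hint
    ((ae_restrict_iff' measurableSet_Ioi).2 (Filter.Eventually.of_forall fun s hs => by
      have : (0 : ℝ) < s := hs
      positivity)), hval]
  congr 1
  have h1 : (((2 * n + 1 : ℕ) : ℝ) + 1) / 2 = n + 1 := by push_cast; ring
  rw [neg_div, h1, Real.rpow_neg hb.le, Real.Gamma_nat_eq_factorial,
    show ((n : ℝ) + 1) = ((n + 1 : ℕ) : ℝ) by push_cast; ring, Real.rpow_natCast, inv_pow]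
  ring

theorem lintegral_norm_pow_mul_exp_arg {b : ℝ} (hb : 0 < b) (n : ℕ) {f : ℝ → ENNReal}
    (hf : Measurable f) (hper : Function.Periodic f (2 * Real.pi)) :
    ∫⁻ w : ℂ, ENNReal.ofReal (‖w‖ ^ (2 * n) * Real.exp (-(b * ‖w‖ ^ 2))) * f (Complex.arg w) =
      ENNReal.ofReal (n.factorial / 2 * b⁻¹ ^ (n + 1)) *
        ∫⁻ θ in Set.Ico 0 (2 * Real.pi), f θ := by
  rw [← Complex.lintegral_comp_polarCoord_symm, ← lintegral_radial hb,
    ← setLIntegral_eq_of_periodic hper, polarCoord_target, Measure.volume_eq_prod,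
    ← Measure.prod_restrict,
    ← lintegral_prod_mul (by fun_prop) hf.aemeasurable, Measure.prod_restrict]
  refine setLIntegral_congr_fun (measurableSet_Ioi.prod measurableSet_Ioo) fun q hq => ?_
  have h0 : 0 < q.1 := hq.1
  have harg : Complex.arg (Complex.polarCoord.symm q) = q.2 := by
    rw [Complex.polarCoord_symm_apply, Complex.ofReal_cos, Complex.ofReal_sin]
    exact Complex.arg_mul_cos_add_sin_mul_I h0 ⟨hq.2.1, hq.2.2.le⟩
  have hnorm : ‖Complex.polarCoord.symm q‖ = q.1 := by
    rw [Complex.norm_polarCoord_symm, abs_of_pos h0]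
  simp only [harg, hnorm, smul_eq_mul]
  rw [← mul_assoc, ← ENNReal.ofReal_mul h0.le, ← mul_assoc, ← pow_succ']

end Polar

/-! ### The uniform measure in affine coordinates -/

section Chart

theorem chartSphere_cons (z w : ℂ) (u : Fin n → ℂ) :
    chartSphere (Fin.cons z u : Fin (n + 1) → ℂ) = chartSphere (Fin.cons w u) := by
  simp [chartSphere, chartVec]

/-- The first entry of `chartSphere c` is positive, so the phase of `w` is the phase of the first
entry of the product. -/
theorem direction_smul_chartVec {w : ℂ} (hw : w ≠ 0) (c : Fin (n + 1) → ℂ) :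
    direction (w • WithLp.toLp 2 (chartVec c)) = withPhase (chartSphere c) (Complex.arg w) := by
  have hc := toLp_chartVec_ne_zero c
  have h0 : ((chartSphere c : CSphere (n + 1)) : CVec (n + 1)) 0 =
      ((‖WithLp.toLp 2 (chartVec c)‖⁻¹ : ℝ) : ℂ) := by
    simp [chartSphere, chartVec]
  have harg : Complex.arg (((chartSphere c : CSphere (n + 1)) : CVec (n + 1)) 0) = 0 := by
    rw [h0, Complex.arg_ofReal_of_nonneg (by positivity)]
  have hexp : Complex.exp (Complex.arg w * Complex.I) = ((‖w‖⁻¹ : ℝ) : ℂ) * w := by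
    nth_rw 3 [← Complex.norm_mul_exp_arg_mul_I w]
    rw [← mul_assoc, ← Complex.ofReal_mul, inv_mul_cancel₀ (norm_ne_zero_iff.2 hw)]
    simp
  refine Subtype.ext ?_
  change _ = Complex.exp (((Complex.arg w - Complex.arg
    (((chartSphere c : CSphere (n + 1)) : CVec (n + 1)) 0) : ℝ) : ℂ) * Complex.I) •
      ((chartSphere c : CSphere (n + 1)) : CVec (n + 1))
  rw [coe_direction (smul_ne_zero hw hc), harg, sub_zero, hexp, norm_smul,
    chartSphere, smul_smul, mul_inv, ← Complex.coe_smul, smul_smul]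
  congr 1
  push_cast
  ring

theorem lintegral_smul_left {w : ℂ} (hw : w ≠ 0) (h : (Fin n → ℂ) → ENNReal) (hh : Measurable h) :
    ∫⁻ x, h x = ENNReal.ofReal (‖w‖ ^ (2 * n)) * ∫⁻ u : Fin n → ℂ, h (w • u) := by
  have hdet : ((LinearMap.lsmul ℂ (Fin n → ℂ) w).restrictScalars ℝ).det = ‖w‖ ^ (2 * n) := by
    rw [LinearMap.det_restrictScalars, Algebra.norm_complex_apply, Complex.normSq_eq_norm_sq,
      show LinearMap.lsmul ℂ (Fin n → ℂ) w = w • LinearMap.id from rfl, LinearMap.det_smul]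
    simp [← pow_mul, mul_comm]
  have hpos : 0 < ‖w‖ ^ (2 * n) := by positivity
  have hmap := Measure.map_linearMap_addHaar_eq_smul_addHaar
    (volume : Measure (Fin n → ℂ)) (f := (LinearMap.lsmul ℂ (Fin n → ℂ) w).restrictScalars ℝ)
    (hdet ▸ hpos.ne')
  have h1 : ∫⁻ u, h (w • u) =
      ∫⁻ x, h x ∂(volume.map ((LinearMap.lsmul ℂ (Fin n → ℂ) w).restrictScalars ℝ)) := by
    rw [lintegral_map hh (LinearMap.continuous_of_finiteDimensional _).measurable]
    rfl
  rw [h1, hmap, lintegral_smul_measure, hdet, smul_eq_mul, ← mul_assoc,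
    ← ENNReal.ofReal_mul hpos.le, abs_of_pos (inv_pos.2 hpos),
    mul_inv_cancel₀ hpos.ne', ENNReal.ofReal_one, one_mul]

theorem periodic_withPhase (v : CSphere (n + 1)) :
    Function.Periodic (withPhase v) (2 * Real.pi) := by
  intro θ
  refine Subtype.ext ?_
  simp only [withPhase]
  congr 1
  have : ((θ + 2 * Real.pi - Complex.arg ((v : CVec (n + 1)) 0) : ℝ) : ℂ) * Complex.I =
      ((θ - Complex.arg ((v : CVec (n + 1)) 0) : ℝ) : ℂ) * Complex.I +
        2 * Real.pi * Complex.I := by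
    push_cast
    ring
  rw [this, Complex.exp_periodic]

theorem measurable_fin_cons {k : ℕ} :
    Measurable fun q : ℂ × (Fin k → ℂ) => (Fin.cons q.1 q.2 : Fin (k + 1) → ℂ) := by
  refine measurable_pi_iff.2 (Fin.cases ?_ fun j => ?_)
  · exact measurable_fst
  · exact (measurable_pi_apply j).comp measurable_snd

theorem lintegral_fin_cons {k : ℕ} {g : (Fin (k + 1) → ℂ) → ENNReal} (hg : Measurable g) :
    ∫⁻ x, g x = ∫⁻ w : ℂ, ∫⁻ x' : Fin k → ℂ, g (Fin.cons w x') := by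
  have h := (volume_preserving_piFinSuccAbove (fun _ : Fin (k + 1) => ℂ) 0).symm
  have hp := lintegral_prod (μ := (volume : Measure ℂ)) (ν := (volume : Measure (Fin k → ℂ)))
    (fun q : ℂ × (Fin k → ℂ) => g (Fin.cons q.1 q.2)) (hg.comp measurable_fin_cons).aemeasurable
  rw [← hp, ← h.lintegral_comp hg, Measure.volume_eq_prod]
  refine lintegral_congr fun q => congrArg g ?_
  simp only [MeasurableEquiv.piFinSuccAbove, Fin.insertNthEquiv_zero]
  rfl

/-- Write a Gaussian vector as `w (1, u)`, with Jacobian `|w|^(2n)` and weight `π^(-(n+1))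
e^(-ν²|w|²)`. The radial part of `w` integrates to `(n!/2) ν^(-2(n+1))`; its argument is the phase,
and normalising that average by `2π` leaves `n!/π^n`. -/
theorem lintegral_haarSphere_chart {f : CSphere (n + 1) → ENNReal} (hf : Measurable f) :
    ∫⁻ v, f v ∂haarSphere (n + 1) = ∫⁻ u : Fin n → ℂ,
      ENNReal.ofReal (n.factorial / Real.pi ^ n *
        ‖WithLp.toLp 2 (chartVec (Fin.cons 0 u))‖⁻¹ ^ (2 * (n + 1))) *
      ((ENNReal.ofReal (2 * Real.pi))⁻¹ *
        ∫⁻ θ in Set.Ico 0 (2 * Real.pi), f (withPhase (chartSphere (Fin.cons 0 u)) θ)) := by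
  set ν : (Fin n → ℂ) → ℝ := fun u => ‖WithLp.toLp 2 (chartVec (Fin.cons 0 u))‖ with hν
  have hν0 : ∀ u, 0 < ν u := fun u => norm_pos_iff.2 (toLp_chartVec_ne_zero _)
  have hconsm : Measurable fun u : Fin n → ℂ => (Fin.cons 0 u : Fin (n + 1) → ℂ) :=
    measurable_fin_cons.comp (measurable_const.prodMk measurable_id)
  have hνm : Measurable ν := by
    have h1 : Measurable fun u : Fin n → ℂ =>
        WithLp.toLp 2 (chartVec (Fin.cons 0 u : Fin (n + 1) → ℂ)) :=
      (WithLp.measurable_toLp 2 _).comp (continuous_chartVec.measurable.comp hconsm)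
    exact h1.norm
  set g : (Fin (n + 1) → ℂ) → ENNReal :=
    fun x => (∏ i, gaussDensity (x i)) * f (direction (WithLp.toLp 2 x)) with hg
  have hgm : Measurable g :=
    (Finset.measurable_prod _ fun i _ => measurable_gaussDensity.comp (measurable_pi_apply i)).mul
      (hf.comp (measurable_direction.comp (WithLp.measurable_toLp 2 _)))
  set k : ℂ → (Fin n → ℂ) → ENNReal := fun w u => ENNReal.ofReal (Real.pi⁻¹ ^ (n + 1)) *
    (ENNReal.ofReal (‖w‖ ^ (2 * n) * Real.exp (-(ν u ^ 2 * ‖w‖ ^ 2))) *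
      f (withPhase (chartSphere (Fin.cons 0 u)) (Complex.arg w))) with hk
  have hkm : Measurable (Function.uncurry k) := by
    refine Measurable.const_mul (Measurable.mul ?_ (hf.comp (measurable_withPhase.comp
      ((measurable_chartSphere.comp (hconsm.comp measurable_snd)).prodMk
        (Complex.measurable_arg.comp measurable_fst))))) _
    have h2 : Measurable fun q : ℂ × (Fin n → ℂ) => ν q.2 := hνm.comp measurable_snd
    fun_prop
  have hfib : ∀ w : ℂ, w ≠ 0 → ∫⁻ x' : Fin n → ℂ, g (Fin.cons w x') = ∫⁻ u, k w u := by
    intro w hw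
    have hgw : Measurable fun x' : Fin n → ℂ => g (Fin.cons w x') :=
      hgm.comp (measurable_fin_cons.comp (measurable_const.prodMk measurable_id))
    rw [lintegral_smul_left hw _ hgw,
      ← lintegral_const_mul' _ _ ENNReal.ofReal_ne_top]
    refine lintegral_congr fun u => ?_
    have hc : (Fin.cons w (w • u) : Fin (n + 1) → ℂ) = w • chartVec (Fin.cons 0 u) := by
      ext i
      refine Fin.cases ?_ (fun j => ?_) i <;> simp [chartVec]
    simp only [hg, hk, hc, prod_gaussDensity_apply]
    rw [WithLp.toLp_smul, direction_smul_chartVec hw, norm_smul, mul_pow,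
      ENNReal.ofReal_mul (by positivity), mul_comm (‖w‖ ^ 2)]
    ring
  rw [lintegral_haarSphere hf, lintegral_fin_cons hgm,
    lintegral_congr_ae (g := fun w => ∫⁻ u, k w u) (by
      filter_upwards [compl_mem_ae_iff.2 (measure_singleton (0 : ℂ))] with w hw
      exact hfib w hw), lintegral_lintegral_swap hkm.aemeasurable]
  refine lintegral_congr fun u => ?_
  have hφm : Measurable fun θ => f (withPhase (chartSphere (Fin.cons 0 u)) θ) :=
    hf.comp (measurable_withPhase.comp (measurable_const.prodMk measurable_id))
  simp only [hk]
  rw [lintegral_const_mul' _ _ ENNReal.ofReal_ne_top,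
    lintegral_norm_pow_mul_exp_arg (pow_pos (hν0 u) 2) n hφm
      fun θ => congrArg f (periodic_withPhase _ θ),
    ← mul_assoc, ← mul_assoc, ← ENNReal.ofReal_inv_of_pos Real.two_pi_pos,
    ← ENNReal.ofReal_mul (by positivity), ← ENNReal.ofReal_mul (by have := hν0 u; positivity)]
  congr 2
  rw [← inv_pow, ← pow_mul, pow_succ Real.pi⁻¹ n, div_eq_mul_inv _ (Real.pi ^ n), ← inv_pow,
    mul_inv]
  ring

end Chart

end DeformedGinibre

namespace DeformedGinibre

/-! ### Measurability, phase invariance and sign of the density -/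

section Density

variable {N : ℕ}

theorem measurable_upperGamma (s : ℝ) : Measurable (upperGamma s) := by
  have h : StronglyMeasurable fun q : ℝ × ℝ =>
      {q : ℝ × ℝ | q.1 < q.2}.indicator (fun q => q.2 ^ (s - 1) * Real.exp (-q.2)) q :=
    (Measurable.indicator (by fun_prop)
      (measurableSet_lt measurable_fst measurable_snd)).stronglyMeasurable
  convert (h.integral_prod_right' (ν := (volume : Measure ℝ))).measurable using 1
  refine funext fun x => ?_
  rw [upperGamma, ← integral_indicator measurableSet_Ioi]
  rfl

theorem measurable_rankOneDensity (a : ℂ) (r l : CVec N) :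
    Measurable fun p : ℂ × CSphere N => rankOneDensity a r l p.1 (p.2 : CVec N) := by
  have h1 : Measurable fun p : ℂ × CSphere N => (p.2 : CVec N) :=
    measurable_subtype_coe.comp measurable_snd
  have hG : ∀ s, Measurable fun p : ℂ × CSphere N => upperGamma s (‖p.1‖ ^ 2) := fun s =>
    (measurable_upperGamma s).comp (by fun_prop)
  have hl : ∀ x : CVec N, Measurable fun p : ℂ × CSphere N => (inner ℂ x (p.2 : CVec N) : ℂ) :=
    fun x => (innerSL ℂ x).continuous.measurable.comp h1
  have hr : ∀ x : CVec N, Measurable fun p : ℂ × CSphere N => (inner ℂ (p.2 : CVec N) x : ℂ) :=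
    fun x => ((continuous_id.inner continuous_const).measurable.comp h1)
  have hc : Measurable fun p : ℂ × CSphere N => conj p.1 :=
    Complex.continuous_conj.measurable.comp measurable_fst
  have hl1 := hl l
  have hl2 := hl r
  have hr1 := hr l
  have hr2 := hr r
  have hG0 := hG N
  have hG1 := hG (N - 1)
  have hG2 := hG (N - 2)
  unfold rankOneDensity
  fun_prop

theorem rankOneDensity_smul (a : ℂ) (r l : CVec N) (z : ℂ) {c : ℂ} (hc : ‖c‖ = 1) (v : CVec N) :
    rankOneDensity a r l z (c • v) = rankOneDensity a r l z v := by
  have h1 : c * conj c = 1 := by rw [Complex.mul_conj, Complex.normSq_eq_norm_sq, hc]; simp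
  have h2 : ∀ x y : CVec N, (inner ℂ x (c • v) * inner ℂ (c • v) y : ℂ) =
      inner ℂ x v * inner ℂ v y := fun x y => by
    rw [inner_smul_right, inner_smul_left, mul_mul_mul_comm, h1, one_mul]
  have h3 : ∀ x : CVec N, ‖(inner ℂ x (c • v) : ℂ)‖ = ‖(inner ℂ x v : ℂ)‖ := fun x => by
    rw [inner_smul_right, norm_mul, hc, one_mul]
  have h4 : ∀ x : CVec N, ‖(inner ℂ (c • v) x : ℂ)‖ = ‖(inner ℂ v x : ℂ)‖ := fun x => by
    rw [inner_smul_left, norm_mul, RCLike.norm_conj, hc, one_mul]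
  simp only [rankOneDensity, h2, h3, h4]

theorem rankOneDensity_withPhase [NeZero N] (a : ℂ) (r l : CVec N) (z : ℂ) (v : CSphere N)
    (θ : ℝ) : rankOneDensity a r l z (withPhase v θ) = rankOneDensity a r l z v :=
  rankOneDensity_smul a r l z (Complex.norm_exp_ofReal_mul_I _) v

/-- The sign is hidden in the closed formula but evident in a frame, where the density is a positive
multiple of a sum of products of positive terms. -/
theorem rankOneDensity_nonneg [NeZero N] (a : ℂ) {r l : CVec N} (hlr : inner ℂ l r = 1) (z : ℂ)
    (v : CSphere N) : 0 ≤ rankOneDensity a r l z v := by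
  obtain ⟨n, rfl⟩ := Nat.exists_eq_succ_of_ne_zero (NeZero.ne N)
  obtain ⟨b, hb0, hb⟩ := exists_frame (v : CVec (n + 1)) (by simp) r
  rw [← hb0, rankOneDensity_eq hlr hb]
  have := frameMoment_nonneg a z r l b
  positivity

end Density

variable {n : ℕ}

theorem lintegral_chartDensity (a : ℂ) {r l : CVec (n + 1)} (hlr : inner ℂ l r = 1)
    (c : Fin (n + 1) → ℂ) :
    ∫⁻ R : Fin (n + 1) → Fin n → ℂ, chartDensity (rankOne a r l) (c, R) =
      ENNReal.ofReal (n.factorial / Real.pi ^ n *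
        ‖(WithLp.toLp 2 (chartVec c) : CVec (n + 1))‖⁻¹ ^ (2 * (n + 1))) *
      ENNReal.ofReal (rankOneDensity a r l (c 0) (chartSphere c)) := by
  obtain ⟨b, hb0, hb⟩ := exists_frame (chartSphere c : CVec (n + 1)) (by simp) r
  rw [lintegral_chart_fiber hb0 hb, ← hb0, rankOneDensity_eq hlr hb,
    ← ENNReal.ofReal_mul (by positivity)]
  congr 1
  have h1 : (n.factorial : ℝ) * (n.factorial : ℝ)⁻¹ = 1 := mul_inv_cancel₀ (by positivity)
  rw [mul_inv, pow_succ Real.pi⁻¹ n, div_eq_mul_inv, ← inv_pow]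
  linear_combination (-(Real.pi⁻¹ ^ n * Real.pi⁻¹ *
    ‖(WithLp.toLp 2 (chartVec c) : CVec (n + 1))‖⁻¹ ^ (2 * (n + 1)) *
    Real.exp (-frameExponent a (c 0) r l b) * frameMoment a (c 0) r l b)) * h1

/-- The fibre integral and the sphere measure in affine coordinates carry the same factor `(n!/π^n)
ν^(-2(n+1))`. What is left over is the density, which passes through the phase average because it is
phase invariant. -/
theorem meanEmpiricalMeasure_rankOne (a : ℂ) {r l : CVec (n + 1)} (hlr : inner ℂ l r = 1) :
    meanEmpiricalMeasure (rankOne a r l) =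
      ((volume : Measure ℂ).prod (haarSphere (n + 1))).withDensity
        fun p => ENNReal.ofReal (rankOneDensity a r l p.1 p.2) := by
  ext s hs
  have hg : Measurable fun X : Fin (n + 1) → Fin (n + 1) → ℂ => ∏ i, ∏ j, gaussDensity (X i j) :=
    Finset.measurable_prod _ fun i _ => Finset.measurable_prod _ fun j _ =>
      measurable_gaussDensity.comp ((measurable_pi_apply j).comp (measurable_pi_apply i))
  have hρ := (measurable_rankOneDensity a r l).ennreal_ofReal
  have hP : Measurable fun c : Fin (n + 1) → ℂ => phaseAverage (c 0) (chartSphere c) s :=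
    (Measure.measurable_coe hs).comp (measurable_phaseAverage.comp
      ((measurable_pi_apply 0).prodMk measurable_chartSphere))
  have hD := measurable_chartDensity (rankOne a r l)
  have hfin : SFinite (haarSphere (n + 1)) := by
    unfold haarSphere
    infer_instance
  rw [meanEmpiricalMeasure_apply hg (pi_pi_complexNormal _ _) _ hs, withDensity_apply _ hs,
    ← lintegral_indicator hs, lintegral_prod _ (hρ.indicator hs).aemeasurable]
  calc _ = ∫⁻ p : Par n, chartDensity (rankOne a r l) p * phaseAverage (p.1 0) (chartSphere p.1) s :=
        rfl
    _ = ∫⁻ c : Fin (n + 1) → ℂ, (∫⁻ R, chartDensity (rankOne a r l) (c, R)) *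
          phaseAverage (c 0) (chartSphere c) s := by
      have hDP : Measurable fun p : Par n =>
          chartDensity (rankOne a r l) p * phaseAverage (p.1 0) (chartSphere p.1) s :=
        hD.mul (hP.comp measurable_fst)
      rw [Measure.volume_eq_prod, lintegral_prod _ hDP.aemeasurable]
      refine lintegral_congr fun c => ?_
      have hDc : Measurable fun R : Fin (n + 1) → Fin n → ℂ =>
          chartDensity (rankOne a r l) (c, R) := hD.comp (measurable_const.prodMk measurable_id)
      exact lintegral_mul_const (phaseAverage (c 0) (chartSphere c) s) hDc
    _ = ∫⁻ z : ℂ, ∫⁻ u : Fin n → ℂ,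
          (∫⁻ R, chartDensity (rankOne a r l) (Fin.cons z u, R)) *
            phaseAverage z (chartSphere (Fin.cons z u)) s :=
      lintegral_fin_cons (hD.lintegral_prod_right'.mul hP)
    _ = _ := by
      refine lintegral_congr fun z => ?_
      have hz : Measurable fun v : CSphere (n + 1) =>
          s.indicator (fun p => ENNReal.ofReal (rankOneDensity a r l p.1 p.2)) (z, v) :=
        (hρ.indicator hs).comp (measurable_const.prodMk measurable_id)
      rw [lintegral_haarSphere_chart hz]
      refine lintegral_congr fun u => ?_
      rw [lintegral_chartDensity a hlr, chartSphere_cons z 0 u, Fin.cons_zero, mul_assoc,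
        phaseAverage_apply _ _ hs]
      have hν : chartVec (Fin.cons z u : Fin (n + 1) → ℂ) = chartVec (Fin.cons 0 u) := by
        simp [chartVec]
      rw [hν, mul_left_comm (ENNReal.ofReal (rankOneDensity _ _ _ _ _)),
        ← lintegral_const_mul' _ _ ENNReal.ofReal_ne_top]
      congr 3
      refine funext fun θ => ?_
      by_cases h : (z, withPhase (chartSphere (Fin.cons 0 u)) θ) ∈ s
      · simp [h, rankOneDensity_withPhase]
      · simp [h]

end DeformedGinibre

end

theorem mainTheorem6 (N : ℕ) [NeZero N] (a : ℂ) (r l : DeformedGinibre.CVec N)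
    (hlr : inner ℂ l r = 1) :
    (∀ (z : ℂ) (v : DeformedGinibre.CSphere N),
      0 ≤ DeformedGinibre.rankOneDensity a r l z v) ∧
    DeformedGinibre.meanEmpiricalMeasure (DeformedGinibre.rankOne a r l) =
      ((volume : Measure ℂ).prod (DeformedGinibre.haarSphere N)).withDensity
        (fun p => ENNReal.ofReal (DeformedGinibre.rankOneDensity a r l p.1 p.2)) ∧
    DeformedGinibre.jointLaw (DeformedGinibre.rankOne a r l) =
      ((volume : Measure ℂ).prod (DeformedGinibre.haarSphere N)).withDensity
        (fun p => ENNReal.ofReal (1 / (N : ℝ) * DeformedGinibre.rankOneDensity a r l p.1 p.2)) := by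
  have hmean : DeformedGinibre.meanEmpiricalMeasure (DeformedGinibre.rankOne a r l) =
      ((volume : Measure ℂ).prod (DeformedGinibre.haarSphere N)).withDensity
        (fun p => ENNReal.ofReal (DeformedGinibre.rankOneDensity a r l p.1 p.2)) := by
    obtain ⟨n, rfl⟩ := Nat.exists_eq_succ_of_ne_zero (NeZero.ne N)
    exact DeformedGinibre.meanEmpiricalMeasure_rankOne a hlr
  refine ⟨fun z v => DeformedGinibre.rankOneDensity_nonneg a hlr z v, hmean, ?_⟩
  have hN : (0 : ℝ) < N := Nat.cast_pos.2 (NeZero.pos N)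
  rw [DeformedGinibre.jointLaw, hmean, ← withDensity_smul _
    (DeformedGinibre.measurable_rankOneDensity a r l).ennreal_ofReal]
  congr 1
  funext p
  rw [Pi.smul_apply, smul_eq_mul, ENNReal.ofReal_mul (by positivity), one_div,
    ENNReal.ofReal_inv_of_pos hN, ENNReal.ofReal_natCast]
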